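/- **Setting.** Let $G=(V,E,w)$ be a finite directed graph with $V=\{0,\dots,n-1\}$, $E\subseteq V\times V$ and $w:E\to\mathbb{R}_{>0}$, and let $S,F\subseteq V$. Put $m=|E|$, $n_S=|S|$, $n_F=|F|$. The algorithm Min-Bottleneck-Cycle$(G,S,F)$ searches for a cycle of $G$ that contains a vertex of $F$ and minimizes the maximum distance between successive visits of the cycle to $S$. It consists of the following steps. 1. For each $s\in S$ compute with Dijkstra's algorithm the shortest path distances $D(s,s')$ in $G$ to all $s'\in S$, and predecessors. (Here and below the shortest path from a vertex to itself is the shortest cycle through it, and the distance is $+\infty$ if there is no path.) 2. Define the graph $G_S$ with vertex set $S$ and weighted adjacency matrix $D$ (entries $+\infty$ are non-edges). 3. For each $s\in S$ compute, with the variant of Dijkstra's algorithm that minimizes the maximum edge weight of a path, the bottleneck distances $D_{\mathrm{bot}}(s,s')$ in $G_S$, and predecessors. 4. Compute with Dijkstra's algorithm the distances and predecessors $D_{F\to S}, P_{F\to S}$ from each vertex of $F$ to the vertices of $S$ in $G$, and $D_{S\to F}, P_{S\to F}$ from each vertex of $S$ to the vertices of $F$; then set $D_{F\to S}(f,s)=D_{S\to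 F}(s,f)=0$ whenever $f=s$. 5. For every $(f,s_1,s_2)\in F\times S\times S$ let $C(f,s_1,s_2)=D_{F\to S}(f,s_1)+D_{S\to F}(s_2,f)$ if $f\ne s_1=s_2$, and $C(f,s_1,s_2)=\max\{D_{F\to S}(f,s_1)+D_{S\to F}(s_2,f),\,D_{\mathrm{bot}}(s_1,s_2)\}$ otherwise. Find a triple $(f^*,s_1^*,s_2^*)$ that minimizes $C$. 6. If the minimum is $+\infty$, output "no cycle exists". Otherwise output the cycle that consists of the paths from $f^*$ to $s_1^*$, from $s_1^*$ to $s_2^*$ and from $s_2^*$ to $f^*$ given by the predecessor matrices (the first is empty if $f^*=s_1^*$, the second if $f^*\ne s_1^*=s_2^*$, the third if $s_2^*=f^*$). The algorithm is implemented as an explicit program for a random access machine with unit-cost operations on natural numbers and exact unit-cost addition, maximum and comparison of weights; its input is given by adjacency lists of $G$ and lists of $S$ and $F$, and Dijkstra's algorithm uses a Fibonacci heap. The running time $T(G,S,F)$ is the number of elementary operations until the program halts. **Proposition.** The program halts on every input with $n\ge 1$, and its running time satisfies the following bounds. * There is an absolute constant $C$ such that, whenever $n\ge2$ and $S\cup F\neq\emptyset$,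 $$T(G,S,F)\le C\,(n_S+n_F)\,(n\log n+m+n_S^2).$$ * There is an absolute constant $C$ such that $T(G,S,F)\le C\,n^3$ whenever $n\ge 1$. * (Sparse graphs, few vertices in $S$.) For every $K$ there is a constant $C$, depending only on $K$, such that, whenever $n\ge2$, $S\cup F\ne\emptyset$, $m\le Kn$ and $n_S^2\le K\,n\log n$, $$T(G,S,F)\le C\,(n_S+n_F)\,n\log n .$$ -/

import Mathlib

/-! ### Graphs -/

/-- A directed graph with vertex set `{0, …, n - 1}` and positive edge weights. Only the values
of `w` on the edge set `E` matter. Self-loops are allowed. -/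
structure WGraph (n : ℕ) where
  E : Finset (Fin n × Fin n)
  w : Fin n × Fin n → ℝ
  w_pos : ∀ e ∈ E, 0 < w e

/-- The set of out-neighbours of `v`. -/
def WGraph.outNbrs {n : ℕ} (G : WGraph n) (v : Fin n) : Finset (Fin n) :=
  Finset.univ.filter (fun u => (v, u) ∈ G.E)

namespace MBC

/-! ### The machine: a unit-cost random access machine with an exact arithmetic on weights

The memory consists of named, two-dimensional arrays of natural numbers and of weights
(a cell `A[i]` of a one-dimensional array is the cell `A[i][0]`, a register is `A[0][0]`).
Every elementary operation (read or write a cell, compare two numbers, add, subtract, take the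
maximum, one round of a loop) is executed through one of the primitives below, and each primitive
adds one to the step counter `time`. The value `none` of the `Option` monad stands for
a computation that does not halt. -/

/-- Names of the arrays of natural numbers. -/
inductive NArr
  -- input: numbers of elements and lists of elements of `V`, `S`, `F`; adjacency lists of `G`
  | numV | numS | numF | listS | listF | adjLen | adjTgt
  -- adjacency lists and vertex list of the graph `G_S`
  | lenS | tgtS | idS
  -- working space of the shortest path computations
  | status | pred
  -- Fibonacci heap
  | parent | kid | pos | deg | mark | tab | slots
  -- predecessor matrices
  | P | Pbot | PFS | PSF
  -- minimizing triple, output cycle in reverse order, output cycle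
  | best | rev | revLen | cyc
  deriving DecidableEq

/-- Names of the arrays of weights (elements of `W` or `+∞`). -/
inductive WArr
  | adjWt | wtS | dist | D | Dbot | DFS | DSF | bestC
  deriving DecidableEq

structure Machine (W : Type) where
  nat : NArr → ℕ → ℕ → ℕ
  wt : WArr → ℕ → ℕ → WithTop W
  time : ℕ

abbrev RAM (W : Type) := StateT (Machine W) Option

section Primitives

variable {W : Type}

def tick : RAM W Unit :=
  fun s => some ((), { s with time := s.time + 1 })

/-- Read the number `A[i][j]`. -/
def rd (A : NArr) (i : ℕ) (j : ℕ := 0) : RAM W ℕ := do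
  tick
  fun s => some (s.nat A i j, s)

/-- `A[i][j] := x`. -/
def wr2 (A : NArr) (i j x : ℕ) : RAM W Unit := do
  tick
  fun s => some ((), { s with
    nat := fun B k l => if B = A ∧ k = i ∧ l = j then x else s.nat B k l })

/-- `A[i] := x`. -/
def wr (A : NArr) (i x : ℕ) : RAM W Unit := wr2 A i 0 x

/-- Read the weight `A[i][j]`. -/
def rdW (A : WArr) (i : ℕ) (j : ℕ := 0) : RAM W (WithTop W) := do
  tick
  fun s => some (s.wt A i j, s)

/-- `A[i][j] := x`. -/
def wrW2 (A : WArr) (i j : ℕ) (x : WithTop W) : RAM W Unit := do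
  tick
  fun s => some ((), { s with
    wt := fun B k l => if B = A ∧ k = i ∧ l = j then x else s.wt B k l })

/-- `A[i] := x`. -/
def wrW (A : WArr) (i : ℕ) (x : WithTop W) : RAM W Unit := wrW2 A i 0 x

def eqN (x y : ℕ) : RAM W Bool := do
  tick
  return decide (x = y)

def ltN (x y : ℕ) : RAM W Bool := do
  tick
  return decide (x < y)

def addN (x y : ℕ) : RAM W ℕ := do
  tick
  return x + y

def subN (x y : ℕ) : RAM W ℕ := do
  tick
  return x - y

def ltW [LinearOrder W] (x y : WithTop W) : RAM W Bool := do
  tick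
  return decide (x < y)

def addW [Add W] (x y : WithTop W) : RAM W (WithTop W) := do
  tick
  return x + y

def maxW [LinearOrder W] (x y : WithTop W) : RAM W (WithTop W) := do
  tick
  return max x y

/-- Run `body 0`, …, `body (k - 1)` in this order. -/
def upTo : ℕ → (ℕ → RAM W Unit) → RAM W Unit
  | 0, _ => tick
  | k + 1, body => do
    upTo k body
    tick
    body k

/-- At most `k` rounds of the loop `iter` below; `none` if it needs more rounds. -/
def iterN {α β : Type} (step : α → RAM W (α ⊕ β)) : ℕ → α → RAM W β
  | 0, _ => fun _ => none
  | k + 1, x => do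
    tick
    match ← step x with
    | .inl y => iterN step k y
    | .inr b => pure b

open Classical in
/-- Repeat `step`, starting from `x`, until it returns a result `Sum.inr b`. -/
noncomputable def iter {α β : Type} (step : α → RAM W (α ⊕ β)) (x : α) : RAM W β :=
  fun s =>
    if h : ∃ k, (iterN step k x s).isSome then iterN step (Nat.find h) x s else none

theorem iterN_mono {α β : Type} (step : α → RAM W (α ⊕ β)) {k l : ℕ} (hkl : k ≤ l) (x : α)
    (s : Machine W) (r : β × Machine W) (h : iterN step k x s = some r) :
    iterN step l x s = some r := by
  induction k generalizing x s l with
  | zero => simp [iterN] at h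
  | succ k ih =>
    obtain ⟨l, rfl⟩ : ∃ l', l = l' + 1 := ⟨l - 1, by omega⟩
    simp only [iterN, bind, StateT.bind, tick, Option.bind_some] at h ⊢
    cases hs : step x { s with time := s.time + 1 } with
    | none => simp [hs] at h
    | some q =>
      obtain ⟨y | b, s'⟩ := q
      · simp only [hs, Option.bind_some] at h ⊢
        exact ih (by omega) _ _ h
      · simpa only [hs, Option.bind_some] using h

theorem iter_eq_some_iff {α β : Type} (step : α → RAM W (α ⊕ β)) (x : α) (s : Machine W)
    (r : β × Machine W) : iter step x s = some r ↔ ∃ k, iterN step k x s = some r := by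
  classical
  constructor
  · intro h
    unfold iter at h
    split_ifs at h with hk
    exact ⟨_, h⟩
  · rintro ⟨k, hk⟩
    have h : ∃ k, (iterN step k x s).isSome := ⟨k, by simp [hk]⟩
    unfold iter
    rw [dif_pos h]
    obtain ⟨r', hr'⟩ := Option.isSome_iff_exists.1 (Nat.find_spec h)
    have h1 := iterN_mono step (le_max_left (Nat.find h) k) x s r' hr'
    have h2 := iterN_mono step (le_max_right (Nat.find h) k) x s r hk
    rw [hr', ← h1, h2]

/-- The loop `iter` satisfies its recursion equation. -/
theorem iter_eq {α β : Type} (step : α → RAM W (α ⊕ β)) (x : α) :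
    iter step x = (do
      tick
      match ← step x with
      | .inl y => iter step y
      | .inr b => pure b) := by
  funext s
  apply Option.ext
  intro r
  rw [iter_eq_some_iff]
  simp only [bind, StateT.bind, tick, Option.bind_some]
  constructor
  · rintro ⟨k, hk⟩
    cases k with
    | zero => simp [iterN] at hk
    | succ k =>
      simp only [iterN, bind, StateT.bind, tick, Option.bind_some] at hk
      cases hs : step x { s with time := s.time + 1 } with
      | none => simp [hs] at hk
      | some q =>
        obtain ⟨y | b, s'⟩ := q
        · simp only [hs, Option.bind_some] at hk ⊢
          exact (iter_eq_some_iff step y s' r).2 ⟨k, hk⟩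
        · simpa only [hs, Option.bind_some] using hk
  · intro h
    cases hs : step x { s with time := s.time + 1 } with
    | none => simp [hs] at h
    | some q =>
      obtain ⟨y | b, s'⟩ := q
      · simp only [hs, Option.bind_some] at h
        obtain ⟨k, hk⟩ := (iter_eq_some_iff step y s' r).1 h
        refine ⟨k + 1, ?_⟩
        simpa only [iterN, bind, StateT.bind, tick, Option.bind_some, hs] using hk
      · refine ⟨1, ?_⟩
        simpa only [iterN, bind, StateT.bind, tick, Option.bind_some, hs] using h

/-- Started on the machine state `μ` with step counter `0`, the program `p` halts after at most
`T` steps. -/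
def HaltsWithin {α : Type} (p : RAM W α) (μ : Machine W) (T : ℝ) : Prop :=
  ∃ (a : α) (μ' : Machine W), p { μ with time := 0 } = some (a, μ') ∧ (μ'.time : ℝ) ≤ T

end Primitives

/-! ### Input format -/

/-- The machine state `μ` contains the number `n` of vertices, a list of the elements of `S`, a
list of the elements of `F` (both without repetitions, in any order), and the adjacency lists
of `G` (in any order), with the edge weights. All other cells are arbitrary. -/
structure Loaded {n : ℕ} (G : WGraph n) (S F : Finset (Fin n)) (μ : Machine ℝ) : Prop where
  numV : μ.nat .numV 0 0 = n
  numS : μ.nat .numS 0 0 = S.card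
  numF : μ.nat .numF 0 0 = F.card
  listS : Set.BijOn (fun k => μ.nat .listS k 0) (Set.Iio S.card) {x | ∃ v ∈ S, (v : ℕ) = x}
  listF : Set.BijOn (fun k => μ.nat .listF k 0) (Set.Iio F.card) {x | ∃ v ∈ F, (v : ℕ) = x}
  adjLen : ∀ v : Fin n, μ.nat .adjLen v 0 = (G.outNbrs v).card
  adjTgt : ∀ v : Fin n, Set.BijOn (fun k => μ.nat .adjTgt v k) (Set.Iio (G.outNbrs v).card)
    {x | ∃ u ∈ G.outNbrs v, (u : ℕ) = x}
  adjWt : ∀ (v u : Fin n) (k : ℕ), k < (G.outNbrs v).card → μ.nat .adjTgt v k = u →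
    μ.wt .adjWt v k = ((G.w (v, u) : ℝ) : WithTop ℝ)

noncomputable section Algorithm

variable {W : Type} [Zero W] [Add W] [LinearOrder W]

/-! ### Fibonacci heap

The elements are vertices `v < N` with keys `dist[v]`; the number `N` is used as null pointer.
`parent[v]` is the parent of `v` in the forest (`N` for a root), `kid[v][0], …, kid[v][deg[v] - 1]`
are its children, `pos[v]` is its position in the list of children of its parent, `mark[v]` is `1`
if `v` is not a root and has lost a child since it last became a child. At most one root has a
given degree: `tab[d]` is the root of degree `d` (`N` if there is none), and `tab[d] = N` for
`d ≥ slots`. -/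

/-- Make the root `c` a child of the root `p`. -/
def link (p c : ℕ) : RAM W Unit := do
  let d ← rd .deg p
  wr2 .kid p d c
  wr .pos c d
  wr .parent c p
  wr .mark c 0
  wr .deg p (← addN d 1)

/-- Remove `c` from the children of `p`; its place is taken by the last child. -/
def unlink (N p c : ℕ) : RAM W Unit := do
  let d ← subN (← rd .deg p) 1
  let i ← rd .pos c
  let x ← rd .kid p d
  wr2 .kid p i x
  wr .pos x i
  wr .deg p d
  wr .parent c N
  wr .mark c 0

/-- Add the tree with root `v` to the table of roots, linking roots of equal degree. -/
def plant (N v : ℕ) : RAM W Unit :=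
  iter (fun v => do
    let d ← rd .deg v
    let r ← rd .tab d
    if ← eqN r N then
      wr .tab d v
      if ← ltN d (← rd .slots 0) then
        return .inr ()
      else
        wr .slots 0 (← addN d 1)
        return .inr ()
    else
      wr .tab d N
      if ← ltW (← rdW .dist v) (← rdW .dist r) then
        link v r
        return .inl v
      else
        link r v
        return .inl r) v

/-- Restore the heap after `dist[v]` has been decreased: cut `v` and, in cascade, its marked
ancestors. -/
def decreaseKey (N v : ℕ) : RAM W Unit := do
  let p ← rd .parent v
  if ← eqN p N then
    return ()
  else if ← ltW (← rdW .dist v) (← rdW .dist p) then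
    iter (fun v => do
      let p ← rd .parent v
      let q ← rd .parent p
      if ← eqN q N then
        wr .tab (← rd .deg p) N
        unlink N p v
        plant N v
        plant N p
        return .inr ()
      else
        unlink N p v
        plant N v
        if ← eqN (← rd .mark p) 1 then
          return .inl p
        else
          wr .mark p 1
          return .inr ()) v
  else
    return ()

/-- Remove an element of minimum key and return it; return `N` if the heap is empty. -/
def extractMin (N : ℕ) : RAM W ℕ := do
  let k ← rd .slots 0
  let u ← iter (fun (i, b) => do
    if ← ltN i k then
      let r ← rd .tab i
      if ← eqN r N then
        return .inl (← addN i 1, b)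
      else if ← eqN b N then
        return .inl (← addN i 1, r)
      else if ← ltW (← rdW .dist r) (← rdW .dist b) then
        return .inl (← addN i 1, r)
      else
        return .inl (← addN i 1, b)
    else
      return .inr b) (0, N)
  if ← eqN u N then
    return N
  else
    let d ← rd .deg u
    wr .tab d N
    wr .deg u 0
    upTo d (fun i => do
      let c ← rd .kid u i
      wr .parent c N
      wr .mark c 0
      plant N c)
    return u

/-! ### Dijkstra's algorithm -/

/-- The length of a path is the sum of its edge lengths, or the maximum of its edge lengths. -/
inductive PathLength
  | sum
  | bottleneck

def PathLength.extend (ℓ : PathLength) (x y : WithTop W) : RAM W (WithTop W) :=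
  match ℓ with
  | .sum => addW x y
  | .bottleneck => maxW x y

/-- The names of the arrays that hold the adjacency lists of a graph: the number of edges out
of `v`, the head and the weight of the `k`-th edge out of `v`. -/
structure GraphArrays where
  len : NArr
  tgt : NArr
  wt : WArr

/-- The input graph `G`. -/
def inputGraph : GraphArrays := ⟨.adjLen, .adjTgt, .adjWt⟩

/-- The graph `G_S`. -/
def graphS : GraphArrays := ⟨.lenS, .tgtS, .wtS⟩

/-- A path to `v` of length `c` with last edge `(u, v)` has been found. The status of a vertex is
`0` if no path to it is known, `1` if it is in the heap, `2` if its distance is final. -/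
def relax (N u v : ℕ) (c : WithTop W) : RAM W Unit := do
  let st ← rd .status v
  if ← eqN st 2 then
    return ()
  else if ← ltW c (← rdW .dist v) then
    wrW .dist v c
    wr .pred v u
    if ← eqN st 0 then
      wr .status v 1
      plant N v
    else
      decreaseKey N v
  else
    return ()

/-- Dijkstra's algorithm with source `s` in a graph with `N` vertices. It computes in `dist[v]`
the minimum length of a path with at least one edge from `s` to `v` (so `dist[s]` is the minimum
length of a cycle through `s`; `+∞` if there is no path) and in `pred[v]` the predecessor of `v`
on such a path. -/
def dijkstra (g : GraphArrays) (ℓ : PathLength) (N s : ℕ) : RAM W Unit := do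
  wr .slots 0 0
  upTo N (fun v => do
    wrW .dist v ⊤
    wr .status v 0
    wr .pred v N
    wr .parent v N
    wr .deg v 0
    wr .mark v 0
    wr .tab v N)
  upTo (← rd g.len s) (fun k => do
    relax N s (← rd g.tgt s k) (← rdW g.wt s k))
  iter (fun () => do
    let u ← extractMin N
    if ← eqN u N then
      return .inr ()
    else
      wr .status u 2
      let du ← rdW .dist u
      upTo (← rd g.len u) (fun k => do
        let c ← ℓ.extend du (← rdW g.wt u k)
        relax N u (← rd g.tgt u k) c)
      return .inl ()) ()

/-- Shortest paths, with respect to `ℓ`, in a graph with `N` vertices, from the vertices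
`A[0], …, A[a - 1]` to the vertices `B[0], …, B[b - 1]`. The distance matrix is stored in
`Dm[i][j]` (`i < a`, `j < b`) and the predecessor matrix in `Pm[i][v]` (`i < a`, `v < N`).
For `ℓ = sum` this is Shortest-Path, for `ℓ = bottleneck` it is Shortest-Bot-Path. -/
def shortestPath (g : GraphArrays) (ℓ : PathLength) (N : ℕ) (A : NArr) (a : ℕ) (B : NArr) (b : ℕ)
    (Dm : WArr) (Pm : NArr) : RAM W Unit :=
  upTo a (fun i => do
    dijkstra g ℓ N (← rd A i)
    upTo b (fun j => do
      wrW2 Dm i j (← rdW .dist (← rd B j)))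
    upTo N (fun v => do
      wr2 Pm i v (← rd .pred v)))

/-! ### The algorithm Min-Bottleneck-Cycle -/

/-- Adjacency lists of the graph `G_S` with vertices `0, …, nS - 1` (vertex `i` stands for the
`i`-th element of `S`) and adjacency matrix `D`; entries `+∞` are non-edges. -/
def buildGraphS (nS : ℕ) : RAM W Unit :=
  upTo nS (fun i => do
    wr .idS i i
    wr .lenS i 0
    upTo nS (fun j => do
      let x ← rdW .D i j
      if ← ltW x ⊤ then
        let k ← rd .lenS i
        wr2 .tgtS i k j
        wrW2 .wtS i k x
        wr .lenS i (← addN k 1)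
      else
        return ()))

/-- Set `DFS[i][j] = 0` and `DSF[j][i] = 0` whenever `F_i = S_j`. -/
def zeroEntries (nF nS : ℕ) : RAM W Unit :=
  upTo nF (fun i =>
    upTo nS (fun j => do
      if ← eqN (← rd .listF i) (← rd .listS j) then
        wrW2 .DFS i j ((0 : W) : WithTop W)
        wrW2 .DSF j i ((0 : W) : WithTop W)
      else
        return ()))

/-- The cost `C(f, s₁, s₂)` of the triple `(F_i, S_j, S_k)`. -/
def tripleCost (i j k : ℕ) : RAM W (WithTop W) := do
  let c ← addW (← rdW .DFS i j) (← rdW .DSF k i)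
  if ← eqN j k then
    if ← eqN (← rd .listF i) (← rd .listS j) then
      maxW c (← rdW .Dbot j k)
    else
      return c
  else
    maxW c (← rdW .Dbot j k)

/-- Search all triples; store the indices of a triple of minimum cost in `best[0]`, `best[1]`,
`best[2]` and its cost in `bestC` (`+∞` if no triple has finite cost). -/
def findBest (nF nS : ℕ) : RAM W Unit := do
  wrW .bestC 0 ⊤
  upTo nF (fun i =>
    upTo nS (fun j =>
      upTo nS (fun k => do
        let c ← tripleCost i j k
        if ← ltW c (← rdW .bestC 0) then
          wrW .bestC 0 c
          wr .best 0 i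
          wr .best 1 j
          wr .best 2 k
        else
          return ())))

/-- Append `x` to the list `rev`. -/
def emit (x : ℕ) : RAM W Unit := do
  let k ← rd .revLen 0
  wr .rev k x
  wr .revLen 0 (← addN k 1)

/-- Append to `rev`, in reverse order, the vertices (without the last vertex `t`) of the path
from `s` to `t` given by row `i` of the predecessor matrix `Pm`. -/
def trace (Pm : NArr) (i s t : ℕ) : RAM W Unit :=
  iter (fun y => do
    let x ← rd Pm i y
    emit x
    if ← eqN x s then
      return .inr ()
    else
      return .inl x) t

/-- The same for the `S`-bottleneck path from `S_j` to `S_k`: a path in `G_S` given by `Pbot`,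
each of its edges being replaced by a path in `G` given by `P`. -/
def traceBot (j k : ℕ) : RAM W Unit :=
  iter (fun b => do
    let a ← rd .Pbot j b
    trace .P a (← rd .listS a) (← rd .listS b)
    if ← eqN a j then
      return .inr ()
    else
      return .inl a) k

/-- Extract the cycle of the triple `(F_i, S_j, S_k)` stored in `best` into `cyc`, and return
the number of entries of `cyc` (the first and the last entry are both `F_i`). -/
def extractCycle : RAM W ℕ := do
  let i ← rd .best 0
  let j ← rd .best 1
  let k ← rd .best 2
  let f ← rd .listF i
  let s₁ ← rd .listS j
  let s₂ ← rd .listS k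
  wr .revLen 0 0
  emit f
  if ← eqN f s₂ then
    pure ()
  else
    trace .PSF k s₂ f
  if ← eqN j k then
    if ← eqN f s₁ then
      traceBot j k
    else
      pure ()
  else
    traceBot j k
  if ← eqN f s₁ then
    pure ()
  else
    trace .PFS i f s₁
  let L ← rd .revLen 0
  upTo L (fun p => do
    wr .cyc p (← rd .rev (← subN (← subN L 1) p)))
  return L

/-- Min-Bottleneck-Cycle. The result is `none` if no cycle exists, and otherwise `some L`, the
cycle being stored as `cyc[0], …, cyc[L - 1]`. -/
def minBottleneckCycle : RAM W (Option ℕ) := do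
  let n ← rd .numV 0
  let nS ← rd .numS 0
  let nF ← rd .numF 0
  shortestPath inputGraph .sum n .listS nS .listS nS .D .P
  buildGraphS nS
  shortestPath graphS .bottleneck nS .idS nS .idS nS .Dbot .Pbot
  shortestPath inputGraph .sum n .listF nF .listS nS .DFS .PFS
  shortestPath inputGraph .sum n .listS nS .listF nF .DSF .PSF
  zeroEntries nF nS
  findBest nF nS
  if ← ltW (← rdW .bestC 0) ⊤ then
    return some (← extractCycle)
  else
    return none

end Algorithm

end MBC

/-!
The program halts and obeys the time bounds for reasons of data structure alone: neither the weights
nor the correctness of the computed distances matter. The proof is a total correctness calculus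
`wp` for the machine, with invariant rules for the two kinds of loops (`wp_upTo`, `wp_iter`), in which
all time bounds are carried as invariants of the step counter.

The heart is the amortized analysis of the Fibonacci heap. The invariant `Heap` describes a forest by
its parent pointers, an acyclicity witness, the lists of children and the table of roots. The
degree bound rests on a condition that does not refer to the order in which children were linked:
among the children of a node, at most `k` have degree plus mark less than `k`. It makes the number of
descendants exponential in the degree (`Heap.two_pow_deg_le`), so degrees are `O(log N)`. With the
potential `pot`, a multiple of the number of roots plus a multiple of the number of marked nodes,
planting a tree and decreasing a key take amortized constant time (`wp_plant`, `wp_decreaseKey`), and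
extracting the minimum takes amortized time `O(log N)` (`wp_extractMin`).

Hence Dijkstra's algorithm runs in time `O(N log N + M)` on a graph with `N` vertices and `M` edges
(`wp_dijkstra`): every vertex is closed once, and every edge is relaxed at most twice. Its invariant
`DState` also says that the predecessor of a closed vertex is the source or was closed earlier.
So the predecessors of every vertex at finite distance lead back to the source within `N` steps
(`PredChain`), which is what makes the extraction of the output cycle halt (`wp_trace`,
`wp_traceBot`): a triple of finite cost consists of such vertices. Adding up the parts of the program
gives `wp_minBottleneckCycle`, from which the three bounds follow by elementary estimates.
-/

namespace MBC

/-! ### Total correctness of programs -/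

section Logic

variable {W : Type}

/-- Weakest precondition for total correctness: `p`, started in the state `s`, halts, and its
result and final state satisfy `Q`. -/
def wp {α : Type} (p : RAM W α) (Q : α → Machine W → Prop) (s : Machine W) : Prop :=
  ∃ a s', p s = some (a, s') ∧ Q a s'

/-- The memory `M` after the assignment `A[i][j] := x`. -/
def upd {κ R : Type} [DecidableEq κ] (M : κ → ℕ → ℕ → R) (A : κ) (i j : ℕ) (x : R) :
    κ → ℕ → ℕ → R :=
  fun B k l => if B = A ∧ k = i ∧ l = j then x else M B k l

theorem upd_of_ne {κ R : Type} [DecidableEq κ] {M : κ → ℕ → ℕ → R} {A B : κ} {i j : ℕ} {x : R}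
    (h : B ≠ A) : upd M A i j x B = M B := by
  funext k l
  simp [upd, h]

theorem wp_mono {α : Type} {p : RAM W α} {Q Q' : α → Machine W → Prop} {s : Machine W}
    (h : wp p Q s) (hQ : ∀ a s', Q a s' → Q' a s') : wp p Q' s := by
  obtain ⟨a, s', h1, h2⟩ := h
  exact ⟨a, s', h1, hQ _ _ h2⟩

theorem wp_bind {α β : Type} (p : RAM W α) (f : α → RAM W β) (Q : β → Machine W → Prop)
    (s : Machine W) : wp (p >>= f) Q s ↔ wp p (fun a s' => wp (f a) Q s') s := by
  unfold wp
  simp only [bind, StateT.bind]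
  cases h : p s with
  | none => simp
  | some q => obtain ⟨a, s'⟩ := q; simp

theorem wp_pure {α : Type} (a : α) (Q : α → Machine W → Prop) (s : Machine W) :
    wp (pure a) Q s ↔ Q a s := by
  simp [wp, pure, StateT.pure]

/-- The step of a primitive, which always succeeds, is computed by evaluation. -/
theorem wp_det {α : Type} {p : RAM W α} {a : α} {s s' : Machine W} (h : p s = some (a, s'))
    (Q : α → Machine W → Prop) : wp p Q s ↔ Q a s' :=
  ⟨fun ⟨_, _, h₁, h₂⟩ => by cases h.symm.trans h₁; exact h₂, fun hQ => ⟨_, _, h, hQ⟩⟩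

theorem wp_tick (Q : Unit → Machine W → Prop) (s : Machine W) :
    wp tick Q s ↔ Q () ⟨s.nat, s.wt, s.time + 1⟩ :=
  wp_det rfl Q

theorem wp_rd (A : NArr) (i j : ℕ) (Q : ℕ → Machine W → Prop) (s : Machine W) :
    wp (rd A i j) Q s ↔ Q (s.nat A i j) ⟨s.nat, s.wt, s.time + 1⟩ :=
  wp_det rfl Q

theorem wp_rdW (A : WArr) (i j : ℕ) (Q : WithTop W → Machine W → Prop) (s : Machine W) :
    wp (rdW A i j) Q s ↔ Q (s.wt A i j) ⟨s.nat, s.wt, s.time + 1⟩ :=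
  wp_det rfl Q

theorem wp_wr2 (A : NArr) (i j x : ℕ) (Q : Unit → Machine W → Prop) (s : Machine W) :
    wp (wr2 A i j x) Q s ↔ Q () ⟨upd s.nat A i j x, s.wt, s.time + 1⟩ :=
  wp_det rfl Q

theorem wp_wr (A : NArr) (i x : ℕ) (Q : Unit → Machine W → Prop) (s : Machine W) :
    wp (wr A i x) Q s ↔ Q () ⟨upd s.nat A i 0 x, s.wt, s.time + 1⟩ :=
  wp_wr2 A i 0 x Q s

theorem wp_wrW2 (A : WArr) (i j : ℕ) (x : WithTop W) (Q : Unit → Machine W → Prop)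
    (s : Machine W) :
    wp (wrW2 A i j x) Q s ↔ Q () ⟨s.nat, upd s.wt A i j x, s.time + 1⟩ :=
  wp_det rfl Q

theorem wp_wrW (A : WArr) (i : ℕ) (x : WithTop W) (Q : Unit → Machine W → Prop)
    (s : Machine W) :
    wp (wrW A i x) Q s ↔ Q () ⟨s.nat, upd s.wt A i 0 x, s.time + 1⟩ :=
  wp_wrW2 A i 0 x Q s

theorem wp_eqN (x y : ℕ) (Q : Bool → Machine W → Prop) (s : Machine W) :
    wp (eqN x y) Q s ↔ Q (decide (x = y)) ⟨s.nat, s.wt, s.time + 1⟩ :=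
  wp_det rfl Q

theorem wp_ltN (x y : ℕ) (Q : Bool → Machine W → Prop) (s : Machine W) :
    wp (ltN x y) Q s ↔ Q (decide (x < y)) ⟨s.nat, s.wt, s.time + 1⟩ :=
  wp_det rfl Q

theorem wp_addN (x y : ℕ) (Q : ℕ → Machine W → Prop) (s : Machine W) :
    wp (addN x y) Q s ↔ Q (x + y) ⟨s.nat, s.wt, s.time + 1⟩ :=
  wp_det rfl Q

theorem wp_subN (x y : ℕ) (Q : ℕ → Machine W → Prop) (s : Machine W) :
    wp (subN x y) Q s ↔ Q (x - y) ⟨s.nat, s.wt, s.time + 1⟩ :=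
  wp_det rfl Q

theorem wp_ltW [LinearOrder W] (x y : WithTop W) (Q : Bool → Machine W → Prop)
    (s : Machine W) :
    wp (ltW x y) Q s ↔ Q (decide (x < y)) ⟨s.nat, s.wt, s.time + 1⟩ :=
  wp_det rfl Q

theorem wp_addW [Add W] (x y : WithTop W) (Q : WithTop W → Machine W → Prop) (s : Machine W) :
    wp (addW x y) Q s ↔ Q (x + y) ⟨s.nat, s.wt, s.time + 1⟩ :=
  wp_det rfl Q

theorem wp_maxW [LinearOrder W] (x y : WithTop W) (Q : WithTop W → Machine W → Prop)
    (s : Machine W) :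
    wp (maxW x y) Q s ↔ Q (max x y) ⟨s.nat, s.wt, s.time + 1⟩ :=
  wp_det rfl Q

theorem wp_ite {α : Type} (c : Prop) [Decidable c] (p q : RAM W α)
    (Q : α → Machine W → Prop) (s : Machine W) :
    wp (if c then p else q) Q s ↔ (c → wp p Q s) ∧ (¬ c → wp q Q s) := by
  split_ifs with h <;> simp [h]

/-- Invariant rule for counting loops. -/
theorem wp_upTo {k : ℕ} {body : ℕ → RAM W Unit} (I : ℕ → Machine W → Prop) {s : Machine W}
    (h0 : I 0 ⟨s.nat, s.wt, s.time + 1⟩)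
    (hs : ∀ i s, i < k → I i s →
      wp (body i) (fun _ s' => I (i + 1) s') ⟨s.nat, s.wt, s.time + 1⟩) :
    wp (upTo k body) (fun _ s' => I k s') s := by
  induction k with
  | zero => rw [upTo, wp_tick]; exact h0
  | succ k ih =>
    rw [upTo, wp_bind]
    refine wp_mono (ih fun i s hi => hs i s (by omega)) fun _ s' h => ?_
    rw [wp_bind, wp_tick]
    exact hs k s' (by omega) h

/-- Invariant rule for `iter`, with a measure `m` that decreases in every round. -/
theorem wp_iter {α β : Type} {step : α → RAM W (α ⊕ β)} (I : α → Machine W → Prop)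
    (m : α → Machine W → ℕ) {Q : β → Machine W → Prop}
    (hs : ∀ x s, I x s → wp (step x) (fun r s' => match r with
      | .inl y => I y s' ∧ m y s' < m x s
      | .inr b => Q b s') ⟨s.nat, s.wt, s.time + 1⟩)
    {x : α} {s : Machine W} (h : I x s) : wp (iter step x) Q s := by
  induction hm : m x s using Nat.strong_induction_on generalizing x s with
  | _ n ih =>
    rw [iter_eq, wp_bind, wp_tick, wp_bind]
    refine wp_mono (hs x s h) fun r s' hr => ?_
    cases r with
    | inl y => exact ih _ (hm ▸ hr.2) hr.1 rfl
    | inr b => exact (wp_pure b Q s').2 hr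

/-- Only the arrays in `ns` and `ws` have changed. -/
def Frame (ns : List NArr) (ws : List WArr) (s s' : Machine W) : Prop :=
  (∀ A, A ∉ ns → s'.nat A = s.nat A) ∧ ∀ A, A ∉ ws → s'.wt A = s.wt A

theorem Frame.refl {ns : List NArr} {ws : List WArr} (s : Machine W) : Frame ns ws s s :=
  ⟨fun _ _ => rfl, fun _ _ => rfl⟩

theorem Frame.trans {ns : List NArr} {ws : List WArr} {s₁ s₂ s₃ : Machine W}
    (h : Frame ns ws s₁ s₂) (h' : Frame ns ws s₂ s₃) : Frame ns ws s₁ s₃ :=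
  ⟨fun A hA => (h'.1 A hA).trans (h.1 A hA), fun A hA => (h'.2 A hA).trans (h.2 A hA)⟩

theorem Frame.mono {ns ns' : List NArr} {ws ws' : List WArr} {s₁ s₂ : Machine W}
    (h : Frame ns ws s₁ s₂) (hn : ns ⊆ ns') (hw : ws ⊆ ws') : Frame ns' ws' s₁ s₂ :=
  ⟨fun A hA => h.1 A fun h => hA (hn h), fun A hA => h.2 A fun h => hA (hw h)⟩

end Logic


/-! ### Structure of the Fibonacci heap -/

/-- The number of binary digits of `N`. -/
def lg (N : ℕ) : ℕ := Nat.log 2 N + 1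

/-- The memory `M` holds a Fibonacci heap with null pointer `N` on the set `X` of nodes. In the course
of an operation the invariant is weakened in two ways. The nodes in `L` are loose: they are roots that
are not in the table of roots, whatever their parent pointer says. And the node `x` may have lost one
child that its mark does not account for (`x = N` if there is no such node). -/
structure Heap (N : ℕ) (X L : Finset ℕ) (x : ℕ) (M : NArr → ℕ → ℕ → ℕ) : Prop where
  lt : ∀ v ∈ X, v < N
  sub : L ⊆ X
  par : ∀ c ∈ X, c ∉ L → M .parent c 0 ≠ N → M .parent c 0 ∈ X
  kid : ∀ v ∈ X, ∀ i < M .deg v 0, M .kid v i ∈ X ∧ M .kid v i ∉ L ∧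
    M .parent (M .kid v i) 0 = v ∧ M .pos (M .kid v i) 0 = i
  pos : ∀ c ∈ X, c ∉ L → M .parent c 0 ≠ N → M .pos c 0 < M .deg (M .parent c 0) 0 ∧
    M .kid (M .parent c 0) (M .pos c 0) = c
  -- a rank that decreases from parents to children; there is no relation to keys
  acyclic : ∃ rk : ℕ → ℕ, ∀ c ∈ X, c ∉ L → M .parent c 0 ≠ N → rk c < rk (M .parent c 0)
  mark : ∀ v ∈ X, M .mark v 0 ≤ 1
  -- The `k`-th child to be linked had degree at least `k` at that time and has lost at most one
  -- child since. This condition says so without reference to the order of the children.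
  count : ∀ p ∈ X, ∀ k, (X.filter fun c => c ∉ L ∧ M .parent c 0 = p ∧
    M .deg c 0 + M .mark c 0 + (if c = x then 1 else 0) < k).card ≤ k
  tab : ∀ d < N, M .tab d 0 = N ∨ (M .tab d 0 ∈ X ∧ M .tab d 0 ∉ L ∧
    M .parent (M .tab d 0) 0 = N ∧ M .deg (M .tab d 0) 0 = d ∧ d < M .slots 0 0)
  root : ∀ v ∈ X, v ∉ L → M .parent v 0 = N → M .tab (M .deg v 0) 0 = v
  slots : M .slots 0 0 ≤ N ∧ M .slots 0 0 ≤ 3 * lg N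

namespace Heap

variable {N : ℕ} {X L : Finset ℕ} {x : ℕ} {M M' : NArr → ℕ → ℕ → ℕ}

/-- The arrays of the heap. -/
abbrev arrs : List NArr := [.parent, .kid, .pos, .deg, .mark, .tab, .slots]

theorem congr (h : Heap N X L x M) (hM : ∀ A ∈ arrs, M' A = M A) : Heap N X L x M' := by
  have h1 := hM .parent (by decide)
  have h2 := hM .kid (by decide)
  have h3 := hM .pos (by decide)
  have h4 := hM .deg (by decide)
  have h5 := hM .mark (by decide)
  have h6 := hM .tab (by decide)
  have h7 := hM .slots (by decide)
  obtain ⟨a, b, c, d, e, f, g, i, j, k, l⟩ := h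
  constructor <;> (try simp only [h1, h2, h3, h4, h5, h6, h7]) <;> assumption

theorem kid_injOn (h : Heap N X L x M) {v : ℕ} (hv : v ∈ X) :
    Set.InjOn (M .kid v) (Finset.range (M .deg v 0)) := by
  intro i hi j hj hij
  have h1 := h.kid v hv i (by simpa using hi)
  have h2 := h.kid v hv j (by simpa using hj)
  rw [← h1.2.2.2, hij, h2.2.2.2]

theorem children_eq (h : Heap N X L x M) {v : ℕ} (hv : v ∈ X) :
    (X.filter fun c => c ∉ L ∧ M .parent c 0 = v) =
      (Finset.range (M .deg v 0)).image (M .kid v) := by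
  ext c
  have := h.lt v hv
  simp only [Finset.mem_filter, Finset.mem_image, Finset.mem_range]
  constructor
  · rintro ⟨hc, hL, rfl⟩
    exact ⟨_, h.pos c hc hL (by omega)⟩
  · rintro ⟨i, hi, rfl⟩
    have := h.kid v hv i hi
    tauto

theorem card_children (h : Heap N X L x M) {v : ℕ} (hv : v ∈ X) :
    (X.filter fun c => c ∉ L ∧ M .parent c 0 = v).card = M .deg v 0 := by
  rw [h.children_eq hv, Finset.card_image_of_injOn (h.kid_injOn hv), Finset.card_range]

theorem parent_ne_self (h : Heap N X L x M) {c : ℕ} (hc : c ∈ X) (hL : c ∉ L) :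
    M .parent c 0 ≠ c := by
  intro he
  obtain ⟨rk, hrk⟩ := h.acyclic
  have := hrk c hc hL (by have := h.lt c hc; omega)
  rw [he] at this
  exact lt_irrefl _ this

/-- If for every `k` at most `k` elements have a value less than `k`, then the values in increasing
order are at least `0, 1, 2, …`. -/
theorem sum_le_sum_of_count {f g : ℕ → ℕ} (hg : Monotone g) {K : Finset ℕ}
    (hf : ∀ k, (K.filter fun c => f c < k).card ≤ k) :
    ∑ i ∈ Finset.range K.card, g i ≤ ∑ c ∈ K, g (f c) := by
  induction hd : K.card generalizing K with
  | zero => simp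
  | succ d ih =>
    obtain ⟨c, hc, hcd⟩ : ∃ c ∈ K, d ≤ f c := by
      by_contra! hlt
      have := hf d
      rw [Finset.filter_true_of_mem hlt] at this
      omega
    have h1 := ih (K := K.erase c) (fun k => (Finset.card_le_card
      (Finset.filter_subset_filter _ (Finset.erase_subset c K))).trans (hf k))
      (by rw [Finset.card_erase_of_mem hc]; omega)
    rw [Finset.sum_range_succ, ← Finset.sum_erase_add _ _ hc]
    exact add_le_add h1 (hg hcd)

/-- The recursion for the minimum number of descendants of a node of degree `d`. The argument
`i - 2` allows the `i`-th child to have lost two children, one by its mark and one as exceptional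
node. -/
theorem two_pow_le_sum (d : ℕ) :
    2 ^ (d / 3) ≤ 1 + ∑ i ∈ Finset.range d, 2 ^ ((i - 2) / 3) := by
  induction d using Nat.strong_induction_on with
  | _ d ih =>
    obtain hd | ⟨e, rfl⟩ : d < 3 ∨ ∃ e, d = e + 3 :=
      (lt_or_ge d 3).imp_right fun h => ⟨d - 3, by omega⟩
    · rw [Nat.div_eq_of_lt hd]; simp
    · have := ih e (by omega)
      rw [Finset.sum_range_succ, show (e + 3) / 3 = e / 3 + 1 by omega, pow_succ,
        Finset.sum_range_succ, Finset.sum_range_succ]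
      rw [show e + 2 - 2 = e by omega]
      have h1 : 0 < 2 ^ ((e - 2) / 3) := by positivity
      have h2 : 0 < 2 ^ ((e + 1 - 2) / 3) := by positivity
      omega

/-- A node with `d` children has at least `2 ^ (d / 3)` descendants. -/
theorem two_pow_deg_le (h : Heap N X L x M) {v : ℕ} (hv : v ∈ X) :
    2 ^ (M .deg v 0 / 3) ≤ N := by
  classical
  obtain ⟨rk, hrk⟩ := h.acyclic
  let R : ℕ → ℕ → Prop := fun c p => c ∈ X ∧ c ∉ L ∧ M .parent c 0 = p ∧ p ≠ N
  have hR : Relator.RightUnique R := fun a b c h1 h2 => h1.2.2.1.symm.trans h2.2.2.1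
  have hmono : ∀ {a b}, Relation.ReflTransGen R a b → rk a ≤ rk b := by
    intro a b hab
    induction hab with
    | refl => exact le_rfl
    | tail _ hbc ih =>
      obtain ⟨h1, h2, h3, h4⟩ := hbc
      have := hrk _ h1 h2 (h3 ▸ h4)
      rw [h3] at this
      omega
  let D : ℕ → Finset ℕ := fun v => X.filter fun u => Relation.ReflTransGen R u v
  -- `D v` contains `v` and, disjointly, the sets `D c` of the children `c` of `v`
  have key : ∀ n, ∀ v ∈ X, rk v = n → 2 ^ (M .deg v 0 / 3) ≤ (D v).card := by
    intro n
    induction n using Nat.strong_induction_on with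
    | _ n ih =>
      intro v hv hn
      have hvN := h.lt v hv
      set K := X.filter fun c => c ∉ L ∧ M .parent c 0 = v with hK
      have hchild : ∀ c ∈ K, R c v ∧ rk c < rk v := by
        intro c hc
        simp only [hK, Finset.mem_filter] at hc
        have hne : M .parent c 0 ≠ N := by omega
        have := hrk c hc.1 hc.2.1 hne
        rw [hc.2.2] at this
        exact ⟨⟨hc.1, hc.2.1, hc.2.2, hvN.ne⟩, this⟩
      have hdisj : (K : Set ℕ).PairwiseDisjoint D := by
        have haux : ∀ c ∈ K, ∀ c' ∈ K, c ≠ c' → ¬ Relation.ReflTransGen R c c' := by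
          intro c hc c' hc' hne hcc
          obtain hcc | ⟨p, hp, hpc⟩ := hcc.cases_head
          · exact hne hcc
          · rw [hR hp (hchild c hc).1] at hpc
            have := hmono hpc
            have := (hchild c' hc').2
            omega
        intro c hc c' hc' hne
        rw [Function.onFun, Finset.disjoint_left]
        intro u hu hu'
        simp only [D, Finset.mem_filter] at hu hu'
        rcases Relation.ReflTransGen.total_of_right_unique hR hu.2 hu'.2 with h1 | h1
        · exact haux c hc c' hc' hne h1
        · exact haux c' hc' c hc hne.symm h1
      have hnot : v ∉ K.biUnion D := by
        simp only [Finset.mem_biUnion, D, Finset.mem_filter, not_exists, not_and]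
        intro c hc _ hvc
        have := hmono hvc
        have := (hchild c hc).2
        omega
      have hsub : insert v (K.biUnion D) ⊆ D v := by
        intro u hu
        simp only [Finset.mem_insert, Finset.mem_biUnion, D, Finset.mem_filter] at hu ⊢
        rcases hu with rfl | ⟨c, hc, hu, huc⟩
        · exact ⟨hv, .refl⟩
        · exact ⟨hu, huc.tail (hchild c hc).1⟩
      have h1 := Finset.card_le_card hsub
      rw [Finset.card_insert_of_notMem hnot, Finset.card_biUnion hdisj] at h1
      have h2 : ∑ c ∈ K, 2 ^ ((M .deg c 0 + M .mark c 0 + (if c = x then 1 else 0) - 2) / 3) ≤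
          ∑ c ∈ K, (D c).card := by
        refine Finset.sum_le_sum fun c hc => ?_
        have hcX := (hchild c hc).1.1
        refine le_trans (Nat.pow_le_pow_right (by norm_num) (Nat.div_le_div_right ?_))
          (ih _ (hn ▸ (hchild c hc).2) c hcX rfl)
        have := h.mark c hcX
        split_ifs <;> omega
      have h3 := sum_le_sum_of_count (K := K) (g := fun i => 2 ^ ((i - 2) / 3))
        (f := fun c => M .deg c 0 + M .mark c 0 + (if c = x then 1 else 0))
        (fun a b hab => Nat.pow_le_pow_right (by norm_num) (Nat.div_le_div_right (by omega)))
        (fun k => by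
          simp only [hK, Finset.filter_filter, and_assoc]
          exact h.count v hv k)
      rw [h.card_children hv] at h3
      have h4 := two_pow_le_sum (M .deg v 0)
      omega
  refine (key _ v hv rfl).trans ((Finset.card_le_card (Finset.filter_subset _ X)).trans ?_)
  calc X.card ≤ (Finset.range N).card :=
        Finset.card_le_card fun v hv => Finset.mem_range.2 (h.lt v hv)
    _ = N := Finset.card_range N

theorem deg_lt_lg (h : Heap N X L x M) {v : ℕ} (hv : v ∈ X) : M .deg v 0 < 3 * lg N := by
  have := Nat.le_log_of_pow_le (by norm_num) (h.two_pow_deg_le hv)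
  unfold lg
  omega

theorem deg_lt (h : Heap N X L x M) {v : ℕ} (hv : v ∈ X) : M .deg v 0 < N := by
  have h1 : insert v (X.filter fun c => c ∉ L ∧ M .parent c 0 = v) ⊆ Finset.range N := by
    intro u hu
    rw [Finset.mem_insert, Finset.mem_filter] at hu
    rw [Finset.mem_range]
    rcases hu with rfl | hu
    exacts [h.lt _ hv, h.lt _ hu.1]
  have h2 := Finset.card_le_card h1
  rw [Finset.card_insert_of_notMem, h.card_children hv, Finset.card_range] at h2
  · exact h2
  · rw [Finset.mem_filter]
    exact fun hh => h.parent_ne_self hv hh.2.1 hh.2.2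

end Heap

/-! ### Elementary changes of the heap -/

namespace Heap

variable {N : ℕ} {X L : Finset ℕ} {x : ℕ} {M M' : NArr → ℕ → ℕ → ℕ}

/-- The loose root `c` becomes a child of the loose root `p`, which has the same degree. -/
theorem link {p c : ℕ} (h : Heap N X L x M) (hp : p ∈ L) (hc : c ∈ L) (hpc : p ≠ c)
    (hd : M .deg p 0 = M .deg c 0)
    (hpar : ∀ y, M' .parent y 0 = if y = c then p else M .parent y 0)
    (hdeg : ∀ y, M' .deg y 0 = if y = p then M .deg p 0 + 1 else M .deg y 0)
    (hkid : ∀ y i, M' .kid y i = if y = p ∧ i = M .deg p 0 then c else M .kid y i)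
    (hpos : ∀ y, M' .pos y 0 = if y = c then M .deg p 0 else M .pos y 0)
    (hmark : ∀ y, M' .mark y 0 = if y = c then 0 else M .mark y 0)
    (htab : M' .tab = M .tab) (hslots : M' .slots = M .slots) :
    Heap N X (L.erase c) x M' := by
  have hpX := h.sub hp
  have hcX := h.sub hc
  have hpN := h.lt p hpX
  refine ⟨h.lt, (Finset.erase_subset c L).trans h.sub, ?_, ?_, ?_, ?_, ?_, ?_, ?_, ?_, ?_⟩
  · have := h.par
    grind
  · have := h.kid
    grind
  · have := h.pos
    grind
  · -- `p` is a root, so its rank may be raised above that of `c`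
    obtain ⟨rk, hrk⟩ := h.acyclic
    refine ⟨fun y => if y = p then max (rk p) (rk c + 1) else rk y, ?_⟩
    grind
  · have := h.mark
    grind
  · intro q hq k
    by_cases hqp : q = p
    · subst hqp
      have hsub : (X.filter fun y => y ∉ L.erase c ∧ M' .parent y 0 = q) ⊆
          insert c (X.filter fun y => y ∉ L ∧ M .parent y 0 = q) := by
        intro y
        simp only [Finset.mem_filter, Finset.mem_insert]
        grind
      obtain hk | hk := lt_or_ge (M .deg q 0) k
      · refine le_trans (Finset.card_le_card (fun y => ?_))
          ((Finset.card_le_card hsub).trans ((Finset.card_insert_le _ _).trans ?_))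
        · simp only [Finset.mem_filter]
          tauto
        · rw [h.card_children hq]
          exact hk
      · refine le_trans (Finset.card_le_card (fun y => ?_)) (h.count q hq k)
        simp only [Finset.mem_filter]
        grind
    · refine le_trans (Finset.card_le_card (fun y => ?_)) (h.count q hq k)
      simp only [Finset.mem_filter]
      grind
  · have := h.tab
    grind
  · have := h.root
    grind
  · rw [hslots]
    exact h.slots

/-- The exceptional node `c` is cut from its parent `p` and becomes a loose root; now `p` is the
exceptional node. If `p` is a root, it has to be loose, since its degree changes. -/
theorem unlink {p c : ℕ} (h : Heap N X L c M) (hc : c ∈ X) (hcL : c ∉ L)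
    (hp : M .parent c 0 = p) (hpN : p ≠ N) (hroot : p ∈ L ∨ M .parent p 0 ≠ N)
    (hpar : ∀ y, M' .parent y 0 = if y = c then N else M .parent y 0)
    (hdeg : ∀ y, M' .deg y 0 = if y = p then M .deg p 0 - 1 else M .deg y 0)
    (hkid : ∀ y i, M' .kid y i = if y = p ∧ i = M .pos c 0 then M .kid p (M .deg p 0 - 1)
      else M .kid y i)
    (hpos : ∀ y, M' .pos y 0 = if y = M .kid p (M .deg p 0 - 1) then M .pos c 0
      else M .pos y 0)
    (hmark : ∀ y, M' .mark y 0 = if y = c then 0 else M .mark y 0)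
    (htab : M' .tab = M .tab) (hslots : M' .slots = M .slots) :
    Heap N X (insert c L) p M' := by
  have hpX : p ∈ X := hp ▸ h.par c hc hcL (hp ▸ hpN)
  have hne : p ≠ c := hp ▸ h.parent_ne_self hc hcL
  have hcp := h.pos c hc hcL (hp ▸ hpN)
  rw [hp] at hcp
  have hlast := h.kid p hpX (M .deg p 0 - 1) (by omega)
  refine ⟨h.lt, ?_, ?_, ?_, ?_, ?_, ?_, ?_, ?_, ?_, ?_⟩
  · have := h.sub
    grind
  · have := h.par
    grind
  · intro v hv i hi
    have := h.kid v hv i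
    have := h.kid v hv (M .pos c 0)
    by_cases hvp : v = p
    · subst hvp
      grind
    · rw [hdeg, if_neg hvp] at hi
      have hki : M' .kid v i = M .kid v i := by rw [hkid, if_neg (by tauto)]
      rw [hki, hpar, hpos]
      grind
  · intro y hy hyL hyN
    have := h.pos y hy
    grind
  · obtain ⟨rk, hrk⟩ := h.acyclic
    exact ⟨rk, by grind⟩
  · have := h.mark
    grind
  · intro q hq k
    refine le_trans (Finset.card_le_card (fun y => ?_)) (h.count q hq k)
    simp only [Finset.mem_filter]
    grind
  · have := h.tab
    grind
  · have := h.root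
    grind
  · rw [hslots]
    exact h.slots

/-- A root is removed from the table of roots. -/
theorem loosen {p : ℕ} (h : Heap N X L x M) (hp : p ∈ X) (hpL : p ∉ L)
    (hpN : M .parent p 0 = N) : Heap N X (insert p L) x (upd M .tab (M .deg p 0) 0 N) := by
  have htab : ∀ d, upd M .tab (M .deg p 0) 0 N .tab d 0 =
      if d = M .deg p 0 then N else M .tab d 0 := fun d => by simp [upd]
  refine ⟨h.lt, ?_, ?_, ?_, ?_, ?_, ?_, ?_, ?_, ?_, ?_⟩ <;>
    (try simp only [htab, upd_of_ne (show NArr.parent ≠ .tab by decide),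
      upd_of_ne (show NArr.kid ≠ .tab by decide), upd_of_ne (show NArr.pos ≠ .tab by decide),
      upd_of_ne (show NArr.deg ≠ .tab by decide), upd_of_ne (show NArr.mark ≠ .tab by decide),
      upd_of_ne (show NArr.slots ≠ .tab by decide)])
  · have := h.sub
    grind
  · have := h.par
    grind
  · have := h.kid
    have := h.lt
    grind
  · have := h.pos
    grind
  · obtain ⟨rk, hrk⟩ := h.acyclic
    exact ⟨rk, by grind⟩
  · exact h.mark
  · intro q hq k
    refine le_trans (Finset.card_le_card (fun y => ?_)) (h.count q hq k)
    simp only [Finset.mem_filter]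
    grind
  · have := h.tab
    have := h.root p hp hpL hpN
    grind
  · have := h.root
    grind
  · exact h.slots

/-- A loose root is entered into the table of roots at a free place. -/
theorem settle {v k : ℕ} (h : Heap N X L x M) (hv : v ∈ L) (hpar : M .parent v 0 = N)
    (htab : M .tab (M .deg v 0) 0 = N)
    (hM : ∀ A, A ≠ .tab → A ≠ .slots → M' A = M A)
    (htab' : ∀ d, M' .tab d 0 = if d = M .deg v 0 then v else M .tab d 0)
    (hslots : M' .slots 0 0 = k) (hk : M .slots 0 0 ≤ k) (hdk : M .deg v 0 < k)
    (hk' : k ≤ max (M .slots 0 0) (M .deg v 0 + 1)) :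
    Heap N X (L.erase v) x M' := by
  have hvX := h.sub hv
  have hvN := h.lt v hvX
  have h1 := h.deg_lt hvX
  have h2 := h.deg_lt_lg hvX
  refine ⟨h.lt, (Finset.erase_subset v L).trans h.sub, ?_, ?_, ?_, ?_, ?_, ?_, ?_, ?_, ?_⟩ <;>
    simp only [htab', hslots, hM .parent (by decide) (by decide),
      hM .kid (by decide) (by decide), hM .pos (by decide) (by decide),
      hM .deg (by decide) (by decide), hM .mark (by decide) (by decide)]
  · have := h.par
    grind
  · have := h.kid
    grind
  · have := h.pos
    grind
  · obtain ⟨rk, hrk⟩ := h.acyclic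
    exact ⟨rk, by grind⟩
  · exact h.mark
  · intro q hq k
    have := h.lt q hq
    refine le_trans (Finset.card_le_card (fun y => ?_)) (h.count q hq k)
    simp only [Finset.mem_filter]
    grind
  · have := h.tab
    grind
  · have := h.root
    have := h.lt
    grind
  · have := h.slots
    omega

/-- A new node without children is a loose root. -/
theorem insert {v : ℕ} (h : Heap N X L x M) (hv : v ∉ X) (hvN : v < N)
    (hpar : M .parent v 0 = N) (hdeg : M .deg v 0 = 0) (hmark : M .mark v 0 = 0) :
    Heap N (insert v X) (insert v L) x M := by
  refine ⟨?_, ?_, ?_, ?_, ?_, ?_, ?_, ?_, ?_, ?_, h.slots⟩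
  · have := h.lt
    grind
  · have := h.sub
    grind
  · have := h.par
    grind
  · have := h.kid
    grind
  · have := h.pos
    grind
  · obtain ⟨rk, hrk⟩ := h.acyclic
    exact ⟨rk, by grind⟩
  · have := h.mark
    grind
  · intro q hq k
    rw [Finset.mem_insert] at hq
    rcases hq with rfl | hq
    · rw [Finset.card_eq_zero.2]
      · omega
      · rw [Finset.filter_eq_empty_iff]
        have := h.par
        grind
    refine le_trans (Finset.card_le_card (fun y => ?_)) (h.count q hq k)
    simp only [Finset.mem_filter]
    grind
  · have := h.tab
    grind
  · have := h.root
    grind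

/-- A loose root is removed from the heap. All its children become loose at once, although their
parent pointers are not yet updated. -/
theorem remove {u : ℕ} (h : Heap N X {u} x M) :
    Heap N (X.erase u) ((Finset.range (M .deg u 0)).image (M .kid u)) x
      (upd M .deg u 0 0) := by
  have hu : u ∈ X := h.sub (by simp)
  have huN := h.lt u hu
  have hdeg : ∀ y, upd M .deg u 0 0 .deg y 0 = if y = u then 0 else M .deg y 0 :=
    fun y => by simp [upd]
  rw [← h.children_eq hu]
  refine ⟨?_, ?_, ?_, ?_, ?_, ?_, ?_, ?_, ?_, ?_, ?_⟩ <;>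
    (try simp only [hdeg, upd_of_ne (show NArr.parent ≠ .deg by decide),
      upd_of_ne (show NArr.kid ≠ .deg by decide), upd_of_ne (show NArr.pos ≠ .deg by decide),
      upd_of_ne (show NArr.tab ≠ .deg by decide), upd_of_ne (show NArr.mark ≠ .deg by decide),
      upd_of_ne (show NArr.slots ≠ .deg by decide)])
  · have := h.lt
    grind
  · grind
  · have := h.par
    grind
  · have := h.kid
    grind
  · have := h.pos
    grind
  · obtain ⟨rk, hrk⟩ := h.acyclic
    exact ⟨rk, by grind⟩
  · have := h.mark
    grind
  · intro q hq k
    refine le_trans (Finset.card_le_card (fun y => ?_)) (h.count q (Finset.mem_of_mem_erase hq) k)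
    simp only [Finset.mem_filter]
    grind
  · have := h.tab
    grind
  · have := h.root
    grind
  · exact h.slots

/-- The parent pointer and the mark of a loose root are irrelevant. -/
theorem reset {c : ℕ} (h : Heap N X L x M) (hc : c ∈ L) :
    Heap N X L x (upd (upd M .parent c 0 N) .mark c 0 0) := by
  have hpar : ∀ y, upd M .parent c 0 N .parent y 0 = if y = c then N else M .parent y 0 :=
    fun y => by simp [upd]
  have hmark : ∀ y, upd (upd M .parent c 0 N) .mark c 0 0 .mark y 0 =
      if y = c then 0 else M .mark y 0 := fun y => by simp [upd]
  refine ⟨h.lt, h.sub, ?_, ?_, ?_, ?_, ?_, ?_, ?_, ?_, ?_⟩ <;>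
    (try simp only [hmark, upd_of_ne (show NArr.parent ≠ .mark by decide), hpar,
      upd_of_ne (show NArr.kid ≠ .mark by decide), upd_of_ne (show NArr.pos ≠ .mark by decide),
      upd_of_ne (show NArr.deg ≠ .mark by decide), upd_of_ne (show NArr.tab ≠ .mark by decide),
      upd_of_ne (show NArr.slots ≠ .mark by decide),
      upd_of_ne (show NArr.kid ≠ .parent by decide),
      upd_of_ne (show NArr.pos ≠ .parent by decide),
      upd_of_ne (show NArr.deg ≠ .parent by decide),
      upd_of_ne (show NArr.tab ≠ .parent by decide),
      upd_of_ne (show NArr.slots ≠ .parent by decide)])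
  · have := h.par
    grind
  · have := h.kid
    grind
  · have := h.pos
    grind
  · obtain ⟨rk, hrk⟩ := h.acyclic
    exact ⟨rk, by grind⟩
  · have := h.mark
    grind
  · intro q hq k
    refine le_trans (Finset.card_le_card (fun y => ?_)) (h.count q hq k)
    simp only [Finset.mem_filter]
    grind
  · have := h.tab
    grind
  · have := h.root
    grind
  · exact h.slots

/-- Marks and the exceptional node may change as long as no child gets a smaller value in the
condition `count`. -/
theorem change {y : ℕ} (h : Heap N X L x M)
    (hM : ∀ A, A ≠ .mark → M' A = M A) (hmark : ∀ v ∈ X, M' .mark v 0 ≤ 1)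
    (heff : ∀ c ∈ X, c ∉ L → M .mark c 0 + (if c = x then 1 else 0) ≤
      M' .mark c 0 + (if c = y then 1 else 0)) : Heap N X L y M' := by
  refine ⟨h.lt, h.sub, ?_, ?_, ?_, ?_, hmark, ?_, ?_, ?_, ?_⟩ <;>
    simp only [hM .parent (by decide), hM .kid (by decide), hM .pos (by decide),
      hM .deg (by decide), hM .tab (by decide), hM .slots (by decide)]
  · exact h.par
  · exact h.kid
  · exact h.pos
  · exact h.acyclic
  · intro q hq k
    refine le_trans (Finset.card_le_card (fun c => ?_)) (h.count q hq k)
    simp only [Finset.mem_filter]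
    rintro ⟨hc, hcL, hcq, hck⟩
    have := heff c hc hcL
    exact ⟨hc, hcL, hcq, by omega⟩
  · exact h.tab
  · exact h.root
  · exact h.slots

end Heap

/-! ### Amortized running time of the heap operations -/

/-- The memory after `link p c`. -/
def linkMem (M : NArr → ℕ → ℕ → ℕ) (p c : ℕ) : NArr → ℕ → ℕ → ℕ :=
  upd (upd (upd (upd (upd M .kid p (M .deg p 0) c) .pos c 0 (M .deg p 0)) .parent c 0 p)
    .mark c 0 0) .deg p 0 (M .deg p 0 + 1)

/-- The memory after `unlink N p c`. -/
def unlinkMem (M : NArr → ℕ → ℕ → ℕ) (N p c : ℕ) : NArr → ℕ → ℕ → ℕ :=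
  upd (upd (upd (upd (upd M .kid p (M .pos c 0) (M .kid p (M .deg p 0 - 1)))
    .pos (M .kid p (M .deg p 0 - 1)) 0 (M .pos c 0)) .deg p 0 (M .deg p 0 - 1))
    .parent c 0 N) .mark c 0 0

/-- The roots of the forest, including the loose ones. -/
def roots (N : ℕ) (X L : Finset ℕ) (M : NArr → ℕ → ℕ → ℕ) : Finset ℕ :=
  X.filter fun v => v ∈ L ∨ M .parent v 0 = N

/-- The marked nodes. -/
def marked (X : Finset ℕ) (M : NArr → ℕ → ℕ → ℕ) : Finset ℕ :=
  X.filter fun v => M .mark v 0 = 1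

/-- The potential of the amortized analysis. A root pays for one round of the loop in `plant`, a
marked node pays for one round of the loop in `decreaseKey`. -/
def pot (N : ℕ) (X L : Finset ℕ) (M : NArr → ℕ → ℕ → ℕ) : ℕ :=
  15 * (roots N X L M).card + 46 * (marked X M).card

/-- The memory cells of vertices outside the heap are unchanged. -/
def Untouched (X : Finset ℕ) (M M' : NArr → ℕ → ℕ → ℕ) : Prop :=
  ∀ y, y ∉ X → M' .parent y 0 = M .parent y 0 ∧ M' .deg y 0 = M .deg y 0 ∧
    M' .mark y 0 = M .mark y 0 ∧ ∀ i, M' .kid y i = M .kid y i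

theorem Untouched.trans {X : Finset ℕ} {M M' M'' : NArr → ℕ → ℕ → ℕ} (h : Untouched X M M')
    (h' : Untouched X M' M'') : Untouched X M M'' := by
  intro y hy
  obtain ⟨h1, h2, h3, h4⟩ := h y hy
  obtain ⟨h1', h2', h3', h4'⟩ := h' y hy
  exact ⟨h1'.trans h1, h2'.trans h2, h3'.trans h3, fun i => (h4' i).trans (h4 i)⟩

/-- What `plant N v` achieves when `L` is the set of loose roots. -/
structure Planted {W : Type} (N : ℕ) (X L : Finset ℕ) (x v : ℕ) (s s' : Machine W) : Prop where
  heap : Heap N X (L.erase v) x s'.nat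
  frame : Frame Heap.arrs [] s s'
  untouched : Untouched X s.nat s'.nat
  nonroot : ∀ y, (s.nat .parent y 0 ≠ N ∨ y ∈ L.erase v) →
    s'.nat .parent y 0 = s.nat .parent y 0 ∧ s'.nat .mark y 0 = s.nat .mark y 0
  marked : marked X s'.nat ⊆ marked X s.nat
  time : s'.time + 15 * (roots N X (L.erase v) s'.nat).card ≤
    s.time + 15 * (roots N X L s.nat).card + 15

section

variable {W : Type}

theorem wp_link (p c : ℕ) (Q : Unit → Machine W → Prop) (s : Machine W) :
    wp (link p c) Q s ↔ Q () ⟨linkMem s.nat p c, s.wt, s.time + 7⟩ := by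
  simp only [link, wp_bind, wp_rd, wp_wr, wp_wr2, wp_addN]
  rfl

theorem wp_unlink (N p c : ℕ) (Q : Unit → Machine W → Prop) (s : Machine W) :
    wp (unlink N p c) Q s ↔ Q () ⟨unlinkMem s.nat N p c, s.wt, s.time + 9⟩ := by
  simp only [unlink, wp_bind, wp_rd, wp_wr, wp_wr2, wp_subN]
  rfl

variable {N : ℕ} {X L : Finset ℕ} {x : ℕ} {M M' : NArr → ℕ → ℕ → ℕ}

theorem Heap.linkMem {p c : ℕ} (h : Heap N X L x M) (hp : p ∈ L) (hc : c ∈ L) (hpc : p ≠ c)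
    (hd : M .deg p 0 = M .deg c 0) : Heap N X (L.erase c) x (linkMem M p c) := by
  apply h.link hp hc hpc hd <;> intros <;> first | rfl | simp [MBC.linkMem, upd]

theorem Heap.unlinkMem {p c : ℕ} (h : Heap N X L c M) (hc : c ∈ X) (hcL : c ∉ L)
    (hp : M .parent c 0 = p) (hpN : p ≠ N) (hroot : p ∈ L ∨ M .parent p 0 ≠ N) :
    Heap N X (Insert.insert c L) p (unlinkMem M N p c) := by
  apply h.unlink hc hcL hp hpN hroot <;> intros <;> first | rfl | simp [MBC.unlinkMem, upd]

theorem linkMem_other {p c : ℕ} {A : NArr} (hA : A ∉ [NArr.kid, .pos, .parent, .mark, .deg]) :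
    linkMem M p c A = M A := by
  simp only [List.mem_cons, List.not_mem_nil, or_false, not_or] at hA
  simp [linkMem, upd_of_ne, hA]

theorem unlinkMem_other {p c : ℕ} {A : NArr}
    (hA : A ∉ [NArr.kid, .pos, .parent, .mark, .deg]) : unlinkMem M N p c A = M A := by
  simp only [List.mem_cons, List.not_mem_nil, or_false, not_or] at hA
  simp [unlinkMem, upd_of_ne, hA]

theorem linkMem_parent (p c y : ℕ) :
    linkMem M p c .parent y 0 = if y = c then p else M .parent y 0 := by
  simp [linkMem, upd]

theorem linkMem_mark (p c y : ℕ) :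
    linkMem M p c .mark y 0 = if y = c then 0 else M .mark y 0 := by
  simp [linkMem, upd]

theorem unlinkMem_parent (N p c y : ℕ) :
    unlinkMem M N p c .parent y 0 = if y = c then N else M .parent y 0 := by
  simp [unlinkMem, upd]

theorem unlinkMem_mark (N p c y : ℕ) :
    unlinkMem M N p c .mark y 0 = if y = c then 0 else M .mark y 0 := by
  simp [unlinkMem, upd]

theorem marked_unlinkMem (N p c : ℕ) :
    marked X (unlinkMem M N p c) ⊆ (marked X M).erase c := by
  intro y
  simp only [marked, Finset.mem_filter, unlinkMem_mark, Finset.mem_erase]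
  grind

theorem roots_unlinkMem (N p c : ℕ) :
    (roots N X (insert c L) (unlinkMem M N p c)).card ≤ (roots N X L M).card + 1 := by
  refine le_trans (Finset.card_le_card fun y => ?_) (Finset.card_insert_le c _)
  simp only [roots, Finset.mem_filter, unlinkMem_parent, Finset.mem_insert]
  grind

theorem untouched_linkMem {p c : ℕ} (hp : p ∈ X) (hc : c ∈ X) :
    Untouched X M (linkMem M p c) := by
  intro y hy
  have h1 : y ≠ p := fun h => hy (h ▸ hp)
  have h2 : y ≠ c := fun h => hy (h ▸ hc)
  simp [linkMem, upd, h1, h2]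

theorem untouched_unlinkMem {p c : ℕ} (hp : p ∈ X) (hc : c ∈ X) :
    Untouched X M (unlinkMem M N p c) := by
  intro y hy
  have h1 : y ≠ p := fun h => hy (h ▸ hp)
  have h2 : y ≠ c := fun h => hy (h ▸ hc)
  simp [unlinkMem, upd, h1, h2]

theorem untouched_tab (d y : ℕ) : Untouched X M (upd M .tab d 0 y) := by
  intro y hy
  simp [upd]

/-- Loop invariant of `plant`: the current tree has the root `v`, and `K` is the set of the other
loose roots. -/
structure PlantInv (N : ℕ) (X K : Finset ℕ) (x T : ℕ) (s₀ : Machine W) (v : ℕ)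
    (s : Machine W) : Prop where
  notMem : v ∉ K
  heap : Heap N X (insert v K) x s.nat
  parent : s.nat .parent v 0 = N
  frame : Frame Heap.arrs [] s₀ s
  untouched : Untouched X s₀.nat s.nat
  nonroot : ∀ y, (s₀.nat .parent y 0 ≠ N ∨ y ∈ K) →
    s.nat .parent y 0 = s₀.nat .parent y 0 ∧ s.nat .mark y 0 = s₀.nat .mark y 0
  marked : marked X s.nat ⊆ marked X s₀.nat
  time : s.time + 15 * (roots N X (insert v K) s.nat).card ≤ T

/-- One round of the loop: a root `r` of the same degree as `v` is in the table, and one of the two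
becomes a child of the other. This lowers the number of roots. -/
theorem PlantInv.link {K : Finset ℕ} {T v p c : ℕ} {s₀ s s' : Machine W}
    (h : PlantInv N X K x T s₀ v s) {r : ℕ} (hr : s.nat .tab (s.nat .deg v 0) 0 = r)
    (hrN : r ≠ N) (hpc : (p = v ∧ c = r) ∨ (p = r ∧ c = v))
    (hnat : s'.nat = linkMem (upd s.nat .tab (s.nat .deg v 0) 0 N) p c) (hwt : s'.wt = s.wt)
    (htime : s'.time ≤ s.time + 15) :
    PlantInv N X K x T s₀ p s' ∧
      (roots N X (insert p K) s'.nat).card < (roots N X (insert v K) s.nat).card := by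
  have hvX : v ∈ X := h.heap.sub (Finset.mem_insert_self v K)
  have hvN := h.heap.lt v hvX
  obtain h0 | ⟨hrX, hrL, hrpar, hrdeg, -⟩ := h.heap.tab _ (h.heap.deg_lt hvX)
  · exact absurd (hr.symm.trans h0) hrN
  rw [hr] at hrX hrL hrpar hrdeg
  have hrv : r ≠ v := fun he => hrL (he ▸ Finset.mem_insert_self v K)
  have hrK : r ∉ K := fun he => hrL (Finset.mem_insert_of_mem he)
  have h1 := h.heap.loosen hrX hrL hrpar
  rw [hrdeg] at h1
  set M₁ := upd s.nat .tab (s.nat .deg v 0) 0 N with hM₁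
  have hpX : p ∈ X := by rcases hpc with ⟨rfl, rfl⟩ | ⟨rfl, rfl⟩ <;> assumption
  have hcX : c ∈ X := by rcases hpc with ⟨rfl, rfl⟩ | ⟨rfl, rfl⟩ <;> assumption
  have hpN := h.heap.lt p hpX
  have hcK : c ∉ K := by rcases hpc with ⟨rfl, rfl⟩ | ⟨rfl, rfl⟩; exacts [hrK, h.notMem]
  have hpK : p ∉ K := by rcases hpc with ⟨rfl, rfl⟩ | ⟨rfl, rfl⟩; exacts [h.notMem, hrK]
  have hcp : p ≠ c := by
    rcases hpc with ⟨rfl, rfl⟩ | ⟨rfl, rfl⟩; exacts [hrv.symm, hrv]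
  have hdeg : M₁ .deg = s.nat .deg := upd_of_ne (by decide)
  have hpar : M₁ .parent = s.nat .parent := upd_of_ne (by decide)
  have hmark : M₁ .mark = s.nat .mark := upd_of_ne (by decide)
  have hcpar : s.nat .parent c 0 = N := by
    rcases hpc with ⟨rfl, rfl⟩ | ⟨rfl, rfl⟩; exacts [hrpar, h.parent]
  have hppar : s.nat .parent p 0 = N := by
    rcases hpc with ⟨rfl, rfl⟩ | ⟨rfl, rfl⟩; exacts [h.parent, hrpar]
  have h2 := h1.linkMem (p := p) (c := c) (by grind) (by grind) hcp (by rw [hdeg]; grind)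
  have hL : (insert r (insert v K)).erase c = insert p K := by
    ext y; simp only [Finset.mem_erase, Finset.mem_insert]; grind
  rw [hL, ← hnat] at h2
  have hroots : (roots N X (insert p K) s'.nat).card <
      (roots N X (insert v K) s.nat).card := by
    refine Finset.card_lt_card (Finset.ssubset_iff_subset_ne.2 ⟨?_, fun he => ?_⟩)
    · intro y
      simp only [roots, Finset.mem_filter, hnat, linkMem_parent, hpar, Finset.mem_insert]
      grind
    · have : c ∈ roots N X (insert v K) s.nat := by simp [roots, hcX, hcpar]
      rw [← he] at this
      simp only [roots, Finset.mem_filter, hnat, linkMem_parent, hpar, Finset.mem_insert] at this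
      grind
  refine ⟨⟨hpK, h2, ?_, h.frame.trans ⟨fun A hA => ?_, fun A _ => by rw [hwt]⟩,
    h.untouched.trans ?_, fun y hy => ?_, fun y hy => ?_, ?_⟩, hroots⟩
  · rw [hnat, linkMem_parent, if_neg hcp, hpar, hppar]
  · simp only [List.mem_cons, List.not_mem_nil, or_false, not_or] at hA
    rw [hnat, linkMem_other (by simp [hA]), hM₁, upd_of_ne (by simp [hA])]
  · rw [hnat]
    exact (untouched_tab _ _).trans (untouched_linkMem hpX hcX)
  · obtain ⟨h3, h4⟩ := h.nonroot y hy
    have hyc : y ≠ c := by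
      rintro rfl
      rcases hy with hy | hy
      · exact hy (h3.symm.trans hcpar)
      · exact hcK hy
    rw [hnat, linkMem_parent, linkMem_mark, if_neg hyc, if_neg hyc, hpar, hmark]
    exact ⟨h3, h4⟩
  · apply h.marked
    simp only [MBC.marked, Finset.mem_filter, hnat, linkMem_mark, hmark] at hy ⊢
    grind
  · have := h.time
    omega

variable [LinearOrder W]

/-- Planting a loose root takes amortized constant time. -/
theorem wp_plant {v : ℕ} {s : Machine W} (h : Heap N X L x s.nat) (hv : v ∈ L)
    (hpar : s.nat .parent v 0 = N) :
    wp (plant N v) (fun _ s' => Planted N X L x v s s') s := by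
  set T := s.time + 15 * (roots N X L s.nat).card with hT
  refine wp_iter (PlantInv N X (L.erase v) x T s)
    (fun w st => (roots N X (insert w (L.erase v)) st.nat).card) ?_
    (⟨by simp, by rwa [Finset.insert_erase hv], hpar, .refl s, fun y _ => ⟨rfl, rfl, rfl,
      fun _ => rfl⟩, fun y _ => ⟨rfl, rfl⟩, fun y hy => hy, by rw [Finset.insert_erase hv]⟩)
  intro v' st I
  have hvL : v' ∈ insert v' (L.erase v) := Finset.mem_insert_self _ _
  have hvX := I.heap.sub hvL
  have hlt := I.heap.deg_lt hvX
  simp only [wp_bind, wp_rd, wp_rdW, wp_eqN, wp_wr, wp_ltW, wp_ltN, wp_addN, wp_ite, wp_pure,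
    wp_link, decide_eq_true_eq]
  refine ⟨fun hr => ?_, fun hr => ⟨fun _ => ?_, fun _ => ?_⟩⟩
  · have hK : (insert v' (L.erase v)).erase v' = L.erase v :=
      Finset.erase_insert I.notMem
    have fin : ∀ s' : Machine W, s'.wt = st.wt →
        (∀ A, A ≠ .tab → A ≠ .slots → s'.nat A = st.nat A) →
        (∀ d, s'.nat .tab d 0 = if d = st.nat .deg v' 0 then v' else st.nat .tab d 0) →
        st.nat .slots 0 0 ≤ s'.nat .slots 0 0 → st.nat .deg v' 0 < s'.nat .slots 0 0 →
        s'.nat .slots 0 0 ≤ max (st.nat .slots 0 0) (st.nat .deg v' 0 + 1) →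
        s'.time ≤ st.time + 15 → Planted N X L x v s s' := by
      intro s' hwt hM htab h1 h2 h3 htime
      have h4 := I.heap.settle hvL I.parent hr hM htab rfl h1 h2 h3
      rw [hK] at h4
      have hp := hM .parent (by decide) (by decide)
      have hm := hM .mark (by decide) (by decide)
      have hk := hM .kid (by decide) (by decide)
      have hd := hM .deg (by decide) (by decide)
      refine ⟨h4, I.frame.trans ⟨fun A hA => ?_, fun A _ => by rw [hwt]⟩,
        I.untouched.trans fun y _ => ?_, fun y hy => ?_, ?_, ?_⟩
      · simp only [List.mem_cons, List.not_mem_nil, or_false, not_or] at hA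
        exact hM A (by simp [hA]) (by simp [hA])
      · rw [hp, hm, hk, hd]
        exact ⟨rfl, rfl, rfl, fun _ => rfl⟩
      · rw [hp, hm]
        exact I.nonroot y hy
      · simp only [MBC.marked, hm]
        exact I.marked
      · have h5 : (roots N X (L.erase v) s'.nat).card ≤
            (roots N X (insert v' (L.erase v)) st.nat).card := by
          refine Finset.card_le_card fun y => ?_
          simp only [roots, Finset.mem_filter, hp, Finset.mem_insert]
          grind
        have := I.time
        omega
    have hslots : upd st.nat .tab (st.nat .deg v' 0) 0 v' .slots = st.nat .slots :=
      upd_of_ne (by decide)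
    rw [hslots]
    refine ⟨fun hd => ?_, fun hd => ?_⟩
    · refine fin _ rfl (fun A h1 h2 => upd_of_ne h1) (fun d => by simp [upd]) ?_ ?_ ?_ ?_ <;>
        simp only [hslots] <;> omega
    · refine fin _ rfl (fun A h1 h2 => ?_) (fun d => ?_) ?_ ?_ ?_ ?_
      · exact (upd_of_ne h2).trans (upd_of_ne h1)
      · simp [upd]
      · simp [upd]; omega
      · simp [upd]
      · simp [upd]
      · simp
  · refine I.link rfl hr (Or.inl ⟨rfl, rfl⟩) ?_ ?_ ?_ <;> rfl
  · refine I.link rfl hr (Or.inr ⟨rfl, rfl⟩) ?_ ?_ ?_ <;> rfl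

theorem Untouched.refl (X : Finset ℕ) (M : NArr → ℕ → ℕ → ℕ) : Untouched X M M :=
  fun _ _ => ⟨rfl, rfl, rfl, fun _ => rfl⟩

/-- Decreasing a key takes amortized constant time. The loop may run along many ancestors of `v`,
but it removes the mark of every node that it cuts, except for `v`, and sets at most one. -/
theorem wp_decreaseKey {v : ℕ} {s : Machine W} (h : Heap N X ∅ N s.nat) (hv : v ∈ X) :
    wp (decreaseKey N v) (fun _ s' => Heap N X ∅ N s'.nat ∧ Frame Heap.arrs [] s s' ∧
      Untouched X s.nat s'.nat ∧ s'.time + pot N X ∅ s'.nat ≤ s.time + pot N X ∅ s.nat + 100)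
      s := by
  have hvN := h.lt v hv
  simp only [decreaseKey, wp_bind, wp_rd, wp_rdW, wp_eqN, wp_ltW, wp_ite, wp_pure,
    decide_eq_true_eq]
  refine ⟨fun _ => ⟨h, .refl s, .refl X s.nat, ?_⟩, fun hp => ⟨fun _ => ?_,
    fun _ => ⟨h, .refl s, .refl X s.nat, ?_⟩⟩⟩
  · omega
  swap
  · omega
  have hmono : ∀ A B : Finset ℕ, A ⊆ B → A.card ≤ B.card := fun _ _ => Finset.card_le_card
  -- The mark of the node that is to be cut does not count, which makes the first round of the loop
  -- like the others.
  set T := s.time + 5 + pot N X ∅ s.nat with hT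
  refine wp_iter (fun v st => Heap N X ∅ v st.nat ∧ v ∈ X ∧ st.nat .parent v 0 ≠ N ∧
      Frame Heap.arrs [] s st ∧ Untouched X s.nat st.nat ∧
      st.time + 15 * (roots N X ∅ st.nat).card + 46 * ((marked X st.nat).erase v).card ≤ T)
    (fun v st => ((marked X st.nat).erase v).card) ?_
    ⟨h.change (fun _ _ => rfl) h.mark (fun c hc _ => ?_), hv, hp, .refl s, .refl X s.nat, ?_⟩
  · rintro v st ⟨hH, hv, hp, hfr, hun, htime⟩
    have hvN := hH.lt v hv
    obtain ⟨p, hpdef⟩ : ∃ p, st.nat .parent v 0 = p := ⟨_, rfl⟩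
    have hpX : p ∈ X := hpdef ▸ hH.par v hv (by simp) hp
    have hpN := hH.lt p hpX
    have hpv : p ≠ v := hpdef ▸ hH.parent_ne_self hv (by simp)
    simp only [wp_bind, wp_rd, wp_eqN, wp_wr, wp_ite, wp_pure, wp_unlink, decide_eq_true_eq,
      hpdef]
    refine ⟨fun hq => ?_, fun hq => ?_⟩
    · have h1 := hH.loosen hpX (by simp) hq
      set M₁ := upd st.nat .tab (st.nat .deg p 0) 0 N with hM₁
      have hpar : M₁ .parent = st.nat .parent := upd_of_ne (by decide)
      have hmark : M₁ .mark = st.nat .mark := upd_of_ne (by decide)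
      rw [insert_empty_eq] at h1
      have h2 := h1.unlinkMem (p := p) hv (by simpa using hpv.symm) (by rw [hpar, hpdef]) hpN.ne
        (Or.inl (by simp))
      refine wp_mono (wp_plant h2 (by simp) (by simp [unlinkMem_parent])) fun _ s₁ P₁ => ?_
      have he : (insert v {p} : Finset ℕ).erase v = {p} :=
        Finset.erase_insert (by simpa using hpv.symm)
      have hH₁ := P₁.heap
      have hn := (P₁.nonroot p (Or.inr (by simp [he]))).1
      have ht₁ := P₁.time
      rw [he] at hH₁ ht₁
      refine wp_mono (wp_plant (hH₁.change (y := N) (fun _ _ => rfl) hH₁.mark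
        (fun c _ hc => ?_)) (by simp) ?_) fun _ s₂ P₂ => ?_
      · rw [if_neg (by simpa using hc)]
        omega
      · rw [hn]
        simp only [unlinkMem_parent, if_neg hpv, hpar]
        exact hq
      have he' : ({p} : Finset ℕ).erase p = ∅ := by simp
      have hH₂ := P₂.heap
      have ht₂ := P₂.time
      rw [he'] at hH₂ ht₂
      refine ⟨hH₂, (hfr.trans (Frame.trans ?_ P₁.frame)).trans P₂.frame,
        (((hun.trans (untouched_tab _ _)).trans (untouched_unlinkMem hpX hv)).trans
          P₁.untouched).trans P₂.untouched, ?_⟩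
      · refine ⟨fun A hA => ?_, fun _ _ => rfl⟩
        simp only [List.mem_cons, List.not_mem_nil, or_false, not_or] at hA
        exact (unlinkMem_other (by simp [hA])).trans (upd_of_ne (by simp [hA]))
      · have h3 := hmono _ _ ((P₂.marked.trans P₁.marked).trans (marked_unlinkMem N p v))
        have h4 := roots_unlinkMem (X := X) (L := {p}) (M := M₁) N p v
        have h5 : (roots N X {p} M₁).card ≤ (roots N X ∅ st.nat).card := by
          refine Finset.card_le_card fun y => ?_
          simp only [roots, Finset.mem_filter, hpar, Finset.mem_singleton]
          grind
        have h6 : marked X M₁ = marked X st.nat := by simp only [marked, hmark]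
        rw [h6] at h3
        dsimp only at ht₁ ht₂
        unfold pot at hT ⊢
        omega
    · have h2 := hH.unlinkMem hv (by simp) hpdef hpN.ne (Or.inr hq)
      rw [insert_empty_eq] at h2
      refine wp_mono (wp_plant h2 (by simp) (by simp [unlinkMem_parent])) fun _ s₁ P₁ => ?_
      have he : ({v} : Finset ℕ).erase v = ∅ := by simp
      have hH₁ := P₁.heap
      have ht₁ := P₁.time
      rw [he] at hH₁ ht₁
      have hn := (P₁.nonroot p (Or.inl (by
        simp only [unlinkMem_parent, if_neg hpv]; exact hq))).1
      have h3 := P₁.marked.trans (marked_unlinkMem N p v)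
      have h4 := roots_unlinkMem (X := X) (L := ∅) (M := st.nat) N p v
      rw [insert_empty_eq] at h4
      have hfr' : Frame Heap.arrs [] s s₁ := by
        refine hfr.trans (Frame.trans ?_ P₁.frame)
        refine ⟨fun A hA => ?_, fun _ _ => rfl⟩
        simp only [List.mem_cons, List.not_mem_nil, or_false, not_or] at hA
        exact unlinkMem_other (by simp [hA])
      have hun' := (hun.trans (untouched_unlinkMem hpX hv)).trans P₁.untouched
      refine ⟨fun hm => ?_, fun hm => ?_⟩
      · have hlt : ((marked X s₁.nat).erase p).card < ((marked X st.nat).erase v).card := by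
          have h5 : p ∈ marked X s₁.nat := Finset.mem_filter.2 ⟨hpX, hm⟩
          have h6 := Finset.card_erase_lt_of_mem h5
          have h7 := hmono _ _ h3
          omega
        refine ⟨⟨hH₁, hpX, ?_, hfr', hun', ?_⟩, hlt⟩
        · rw [hn]
          simp only [unlinkMem_parent, if_neg hpv]
          exact hq
        · simp only at ht₁ ⊢
          omega
      · have hmk : ∀ y, upd s₁.nat .mark p 0 1 .mark y 0 =
            if y = p then 1 else s₁.nat .mark y 0 := fun y => by simp [upd]
        have hmp : s₁.nat .mark p 0 = 0 := by
          have := hH₁.mark p hpX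
          omega
        refine ⟨hH₁.change (fun A hA => upd_of_ne hA) (fun y hy => ?_) (fun c hc _ => ?_),
          hfr'.trans ?_,
          hun'.trans fun y hy => ?_, ?_⟩
        · rw [hmk]
          have := hH₁.mark y hy
          split_ifs <;> omega
        · rw [hmk]
          split_ifs with h5 <;> subst_vars <;> omega
        · exact ⟨fun A hA => upd_of_ne fun h => hA (by simp [h]), fun _ _ => rfl⟩
        · have hyp : y ≠ p := fun h => hy (h ▸ hpX)
          simp [upd, hyp]
        · have h5 : marked X (upd s₁.nat .mark p 0 1) ⊆ insert p (marked X s₁.nat) := by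
            intro y
            simp only [marked, Finset.mem_filter, hmk, Finset.mem_insert]
            grind
          have h6 := (hmono _ _ h5).trans (Finset.card_insert_le _ _)
          have h7 := hmono _ _ h3
          have h8 : roots N X ∅ (upd s₁.nat .mark p 0 1) = roots N X ∅ s₁.nat := by
            simp only [roots, upd_of_ne (show NArr.parent ≠ .mark by decide)]
          dsimp only at ht₁ ⊢
          unfold pot at hT ⊢
          rw [h8]
          omega
  · have := h.lt c hc
    dsimp only
    split_ifs <;> omega
  · have := hmono _ _ (Finset.erase_subset v (marked X s.nat))
    dsimp only
    unfold pot at hT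
    omega

/-- A forest without entries in the table of roots is empty: by acyclicity every nonempty forest
has a root. -/
theorem Heap.eq_empty (h : Heap N X ∅ x M) (htab : ∀ d < M .slots 0 0, M .tab d 0 = N) :
    X = ∅ := by
  by_contra hX
  obtain ⟨rk, hrk⟩ := h.acyclic
  obtain ⟨v, hv, hmax⟩ := X.exists_max_image rk (Finset.nonempty_iff_ne_empty.2 hX)
  have hroot : M .parent v 0 = N := by
    by_contra hne
    have h1 := hmax _ (h.par v hv (by simp) hne)
    have h2 := hrk v hv (by simp) hne
    omega
  have h1 := h.root v hv (by simp) hroot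
  have h2 := h.tab _ (h.deg_lt hv)
  have h3 := h.lt v hv
  rw [h1] at h2
  have h4 := htab (M .deg v 0) (by omega)
  omega

/-- Extracting the minimum takes amortized time `O(lg N)`. -/
theorem wp_extractMin {s : Machine W} (h : Heap N X ∅ N s.nat) :
    wp (extractMin N) (fun u s' => Frame Heap.arrs [] s s' ∧
      ((u = N ∧ X = ∅ ∧ s'.nat = s.nat ∧ s'.time ≤ s.time + 160 * lg N) ∨
        (u ∈ X ∧ Heap N (X.erase u) ∅ N s'.nat ∧ Untouched X s.nat s'.nat ∧
          s'.time + pot N (X.erase u) ∅ s'.nat ≤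
            s.time + pot N X ∅ s.nat + 160 * lg N))) s := by
  have hlg : 1 ≤ lg N := by unfold lg; omega
  simp only [extractMin, wp_bind, wp_rd]
  set k := s.nat .slots 0 0 with hk
  have hslots := h.slots
  rw [← hk] at hslots
  refine wp_mono (wp_iter (Q := fun u st => ∃ t ≤ s.time + 3 + 9 * k,
      st = ⟨s.nat, s.wt, t⟩ ∧ (u = N → ∀ j < k, s.nat .tab j 0 = N) ∧
        (u ≠ N → ∃ j < k, s.nat .tab j 0 = u))
    (fun y st => ∃ t ≤ s.time + 1 + 9 * y.1, st = ⟨s.nat, s.wt, t⟩ ∧ y.1 ≤ k ∧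
      (y.2 = N → ∀ j < y.1, s.nat .tab j 0 = N) ∧
      (y.2 ≠ N → ∃ j < y.1, s.nat .tab j 0 = y.2))
    (fun y _ => k - y.1) ?_ ⟨s.time + 1, by simp, rfl, by simp, by simp, by simp⟩) ?_
  · rintro ⟨i, b⟩ st ⟨t, ht, rfl, hi, hb, hb'⟩
    dsimp only at ht hi hb hb'
    simp only [wp_bind, wp_rd, wp_rdW, wp_eqN, wp_ltN, wp_ltW, wp_addN, wp_ite, wp_pure,
      decide_eq_true_eq]
    have hnew : s.nat .tab i 0 ≠ N → ∃ j < i + 1, s.nat .tab j 0 = s.nat .tab i 0 :=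
      fun _ => ⟨i, by omega, rfl⟩
    have hold : b ≠ N → ∃ j < i + 1, s.nat .tab j 0 = b := fun hn =>
      (hb' hn).imp fun j hj => ⟨by omega, hj.2⟩
    refine ⟨fun hik => ⟨fun hr => ?_, fun hr => ⟨fun hbN => ?_, fun hbN => ⟨fun _ => ?_,
      fun _ => ?_⟩⟩⟩, fun hik => ?_⟩
    · refine ⟨⟨_, by omega, rfl, by omega, fun hn j hj => ?_, hold⟩, by omega⟩
      obtain hj | rfl : j < i ∨ j = i := by omega
      · exact hb hn j hj
      · exact hr
    · exact ⟨⟨_, by omega, rfl, by omega, fun hn => absurd hn hr, hnew⟩, by omega⟩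
    · exact ⟨⟨_, by omega, rfl, by omega, fun hn => absurd hn hr, hnew⟩, by omega⟩
    · exact ⟨⟨_, by omega, rfl, by omega, fun hn => absurd hn hbN, hold⟩, by omega⟩
    · obtain rfl : i = k := by omega
      exact ⟨_, by omega, rfl, hb, hb'⟩
  rintro u st ⟨t, ht, rfl, hu, hu'⟩
  simp only [wp_bind, wp_rd, wp_wr, wp_eqN, wp_ite, wp_pure, decide_eq_true_eq]
  refine ⟨fun huN => ⟨.refl _, Or.inl ⟨trivial, h.eq_empty (hu huN), trivial, by omega⟩⟩,
    fun huN => ?_⟩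
  obtain ⟨j, hj, hju⟩ := hu' huN
  obtain h0 | ⟨huX, -, hupar, hudeg, -⟩ := h.tab j (by omega)
  · exact absurd (hju.symm.trans h0) huN
  rw [hju] at huX hupar hudeg
  have hinj := h.kid_injOn huX
  have hdlg := h.deg_lt_lg huX
  set d := s.nat .deg u 0 with hd
  set M₁ := upd s.nat .tab d 0 N with hM₁
  set M₂ := upd M₁ .deg u 0 0 with hM₂
  have h1 := h.loosen huX (by simp) hupar
  rw [insert_empty_eq] at h1
  have h2 := h1.remove
  have hM₁deg : M₁ .deg = s.nat .deg := upd_of_ne (by decide)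
  have hM₁kid : M₁ .kid = s.nat .kid := upd_of_ne (by decide)
  have hM₂other : ∀ A, A ≠ .tab → A ≠ .deg → M₂ A = s.nat A := fun A hA hA' =>
    (upd_of_ne hA').trans (upd_of_ne hA)
  rw [← hd, ← hM₁, hM₁deg, hM₁kid, ← hd, ← hM₂, Finset.range_eq_Ico] at h2
  -- the children of `u` that remain loose after `i` rounds
  set Lf : ℕ → Finset ℕ := fun i => (Finset.Ico i d).image (s.nat .kid u) with hLf
  have hroots₀ : (roots N (X.erase u) (Lf 0) M₂).card ≤ (roots N X ∅ s.nat).card + d := by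
    have : roots N (X.erase u) (Lf 0) M₂ ⊆ roots N X ∅ s.nat ∪ Lf 0 := by
      intro y
      simp only [roots, Finset.mem_filter, Finset.mem_union,
        hM₂other .parent (by decide) (by decide)]
      grind
    refine (Finset.card_le_card this).trans ((Finset.card_union_le _ _).trans ?_)
    have : (Lf 0).card ≤ _ := Finset.card_image_le
    rw [Nat.card_Ico] at this
    omega
  have hmarked₀ : (marked (X.erase u) M₂).card ≤ (marked X s.nat).card := by
    refine Finset.card_le_card ?_
    simp only [marked, hM₂other .mark (by decide) (by decide)]
    exact Finset.filter_subset_filter _ (Finset.erase_subset u X)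
  refine wp_mono (wp_upTo (fun i st => Heap N (X.erase u) (Lf i) N st.nat ∧
      (∀ j, st.nat .kid u j = s.nat .kid u j) ∧ Frame Heap.arrs [] s st ∧
      Untouched X s.nat st.nat ∧
      st.time + pot N (X.erase u) (Lf i) st.nat ≤
        s.time + pot N X ∅ s.nat + 8 + 9 * k + 15 * d + 19 * i) ?_ ?_) ?_
  · refine ⟨h2, fun j => congrFun (congrFun (hM₂other .kid (by decide) (by decide)) u) j, ⟨fun A hA => ?_,
      fun _ _ => rfl⟩, fun y hy => ?_, ?_⟩
    · simp only [List.mem_cons, List.not_mem_nil, or_false, not_or] at hA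
      exact hM₂other A (by simp [hA]) (by simp [hA])
    · have hyu : y ≠ u := fun h => hy (h ▸ huX)
      simp [hM₂, hM₁, upd, hyu]
    · unfold pot
      dsimp only
      omega
  · rintro i st hi ⟨hH, hkid, hfr, hun, htime⟩
    simp only [wp_bind, wp_rd, wp_wr, hkid]
    set c := s.nat .kid u i with hc
    have hcL : c ∈ Lf i := Finset.mem_image.2 ⟨i, Finset.mem_Ico.2 ⟨le_rfl, hi⟩, rfl⟩
    have hcX := hH.sub hcL
    have hLe : (Lf i).erase c = Lf (i + 1) := by
      ext y
      simp only [hLf, Finset.mem_erase, Finset.mem_image, Finset.mem_Ico]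
      constructor
      · rintro ⟨hne, j, hj, rfl⟩
        exact ⟨j, ⟨Nat.lt_of_le_of_ne hj.1 fun h => hne (by rw [hc, h]), hj.2⟩, rfl⟩
      · rintro ⟨j, hj, rfl⟩
        refine ⟨fun he => ?_, j, ⟨by omega, hj.2⟩, rfl⟩
        have := hinj (by simpa using hj.2) (by simpa using hi) he
        omega
    set M₃ := upd (upd st.nat .parent c 0 N) .mark c 0 0 with hM₃
    have hpar : ∀ y, M₃ .parent y 0 = if y = c then N else st.nat .parent y 0 :=
      fun y => by simp [hM₃, upd]
    have hmark : ∀ y, M₃ .mark y 0 = if y = c then 0 else st.nat .mark y 0 :=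
      fun y => by simp [hM₃, upd]
    refine wp_mono (wp_plant (hH.reset hcL) hcL ((hpar c).trans (if_pos rfl))) fun _ s₁ P => ?_
    have hH₁ := P.heap
    have ht := P.time
    rw [hLe] at hH₁ ht
    have h3 : (roots N (X.erase u) (Lf i) M₃).card ≤
        (roots N (X.erase u) (Lf i) st.nat).card := by
      refine Finset.card_le_card fun y => ?_
      simp only [roots, Finset.mem_filter, hpar]
      grind
    have h4 : (marked (X.erase u) s₁.nat).card ≤ (marked (X.erase u) st.nat).card := by
      refine Finset.card_le_card (P.marked.trans fun y => ?_)
      simp only [marked, Finset.mem_filter, hmark]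
      grind
    refine ⟨hH₁, fun j => ?_, hfr.trans (Frame.trans ?_ P.frame), ?_, ?_⟩
    · rw [(P.untouched u (by simp)).2.2.2]
      simp only [hM₃, upd_of_ne (show NArr.kid ≠ .mark by decide),
        upd_of_ne (show NArr.kid ≠ .parent by decide), hkid]
    · refine ⟨fun A hA => ?_, fun _ _ => rfl⟩
      simp only [List.mem_cons, List.not_mem_nil, or_false, not_or] at hA
      exact (upd_of_ne (by simp [hA])).trans (upd_of_ne (by simp [hA]))
    · refine (hun.trans fun y hy => ?_).trans
        (fun y hy => P.untouched y fun h => hy (Finset.mem_of_mem_erase h))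
      have hyc : y ≠ c := fun h => hy (h ▸ Finset.mem_of_mem_erase hcX)
      simp [hM₃, upd, hyc]
    · dsimp only at ht
      unfold pot at htime ⊢
      omega
  · rintro _ st ⟨hH, -, hfr, hun, htime⟩
    have hLd : Lf d = ∅ := by simp [hLf]
    rw [hLd] at hH htime
    exact ⟨hfr, Or.inr ⟨huX, hH, hun, by omega⟩⟩

end

/-! ### Dijkstra's algorithm -/

/-- The vertices whose status is `1`, that is, the vertices in the heap. -/
def opened (N : ℕ) (M : NArr → ℕ → ℕ → ℕ) : Finset ℕ :=
  (Finset.range N).filter fun v => M .status v 0 = 1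

/-- The vertices whose status is `2`, that is, the vertices whose distance is final. -/
def closed (N : ℕ) (M : NArr → ℕ → ℕ → ℕ) : Finset ℕ :=
  (Finset.range N).filter fun v => M .status v 0 = 2

/-- The arrays that Dijkstra's algorithm changes. -/
abbrev dijArrs : List NArr := .status :: .pred :: Heap.arrs

/-- For all vertices `v` with property `reach`, the chain `v, pr v, pr (pr v), …` arrives at the
source `s₀` through edges of the graph `E`; the strictly decreasing numbers `ord` bound its
length. -/
def PredChain (E : ℕ → ℕ → Prop) (N s₀ : ℕ) (pr : ℕ → ℕ) (reach : ℕ → Prop) : Prop :=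
  ∃ ord : ℕ → ℕ, ∀ v < N, reach v → ord v < N ∧ pr v < N ∧ E (pr v) v ∧
    (pr v = s₀ ∨ (reach (pr v) ∧ ord (pr v) < ord v))

/-- The invariant of Dijkstra's algorithm with source `s₀` in the graph `E`. It does not mention
the values of the distances, since these matter neither for halting nor for the running time.
The numbers `ord` are the positions of the vertices in the order in which they are closed. -/
structure DState {W : Type} (E : ℕ → ℕ → Prop) (N s₀ : ℕ) (s : Machine W) : Prop where
  heap : Heap N (opened N s.nat) ∅ N s.nat
  status : ∀ v < N, s.nat .status v 0 ≤ 2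
  fresh : ∀ v < N, s.nat .status v 0 = 0 → s.nat .parent v 0 = N ∧ s.nat .deg v 0 = 0 ∧
    s.nat .mark v 0 = 0 ∧ s.wt .dist v 0 = ⊤
  order : ∃ ord : ℕ → ℕ, ∀ v < N, s.nat .status v 0 ≠ 0 → s.nat .pred v 0 < N ∧
    E (s.nat .pred v 0) v ∧
    (s.nat .pred v 0 = s₀ ∨ (s.nat .status (s.nat .pred v 0) 0 = 2 ∧
      (s.nat .status v 0 = 2 → ord (s.nat .pred v 0) < ord v))) ∧
    (s.nat .status v 0 = 2 → ord v < (closed N s.nat).card)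

section

variable {W : Type} {E : ℕ → ℕ → Prop} {N s₀ : ℕ} {M M' : NArr → ℕ → ℕ → ℕ}

theorem mem_opened {v : ℕ} : v ∈ opened N M ↔ v < N ∧ M .status v 0 = 1 := by simp [opened]

theorem mem_closed {v : ℕ} : v ∈ closed N M ↔ v < N ∧ M .status v 0 = 2 := by simp [closed]

/-- The invariant survives when an edge from `u` to a vertex `v` that is not closed is used. -/
theorem DState.relaxed {s s' : Machine W} (h : DState E N s₀ s) {u v : ℕ} (hv : v < N)
    (hu : u < N) (hE : E u v) (hus : u = s₀ ∨ s.nat .status u 0 = 2)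
    (hv2 : s.nat .status v 0 ≠ 2)
    (hheap : Heap N (opened N s'.nat) ∅ N s'.nat)
    (hstatus : ∀ y, s'.nat .status y 0 = if y = v then 1 else s.nat .status y 0)
    (hpred : ∀ y, s'.nat .pred y 0 = if y = v then u else s.nat .pred y 0)
    (hdist : ∀ y, y ≠ v → s'.wt .dist y 0 = s.wt .dist y 0)
    (hun : Untouched (insert v (opened N s.nat)) s.nat s'.nat) : DState E N s₀ s' := by
  have hclosed : closed N s'.nat = closed N s.nat := by
    ext y
    simp only [mem_closed, hstatus]
    grind
  refine ⟨hheap, fun y hy => ?_, fun y hy h0 => ?_, ?_⟩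
  · have := h.status y hy
    rw [hstatus]
    split_ifs <;> omega
  · rw [hstatus] at h0
    by_cases hyv : y = v
    · simp [hyv] at h0
    rw [if_neg hyv] at h0
    obtain ⟨h1, h2, h3, -⟩ := hun y (by simp [mem_opened, hyv, h0])
    rw [h1, h2, h3, hdist y hyv]
    exact h.fresh y hy h0
  · obtain ⟨ord, hord⟩ := h.order
    refine ⟨ord, fun y hy hy0 => ?_⟩
    rw [hclosed]
    have h1 := hord y hy
    simp only [hstatus, hpred] at hy0 ⊢
    by_cases hyv : y = v
    · subst hyv
      simp only [if_true]
      refine ⟨hu, hE, hus.imp_right fun h2 => ⟨?_, by simp⟩, by simp⟩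
      split_ifs with h3
      · exact absurd (h3 ▸ h2) hv2
      · exact h2
    · simp only [if_neg hyv] at hy0 ⊢
      obtain ⟨h2, h3, h4, h5⟩ := h1 hy0
      refine ⟨h2, h3, h4.imp_right fun h6 => ⟨?_, h6.2⟩, h5⟩
      split_ifs with h7
      · exact absurd (h7 ▸ h6.1) hv2
      · exact h6.1

/-- The invariant survives when the vertex `u`, just extracted from the heap, is closed. -/
theorem DState.close {s s' : Machine W} (h : DState E N s₀ s) {u : ℕ}
    (hu : u ∈ opened N s.nat)
    (hheap : Heap N ((opened N s.nat).erase u) ∅ N s'.nat)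
    (hstatus : ∀ y, s'.nat .status y 0 = if y = u then 2 else s.nat .status y 0)
    (hpred : s'.nat .pred = s.nat .pred) (hdist : s'.wt = s.wt)
    (hun : Untouched (opened N s.nat) s.nat s'.nat) :
    DState E N s₀ s' ∧ opened N s'.nat = (opened N s.nat).erase u ∧
      closed N s'.nat = insert u (closed N s.nat) := by
  obtain ⟨huN, hu1⟩ := mem_opened.1 hu
  have hop : opened N s'.nat = (opened N s.nat).erase u := by
    ext y
    simp only [mem_opened, hstatus, Finset.mem_erase]
    grind
  have hcl : closed N s'.nat = insert u (closed N s.nat) := by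
    ext y
    simp only [mem_closed, hstatus, Finset.mem_insert]
    grind
  refine ⟨⟨hop ▸ hheap, fun y hy => ?_, fun y hy h0 => ?_, ?_⟩, hop, hcl⟩
  · have := h.status y hy
    rw [hstatus]
    split_ifs <;> omega
  · rw [hstatus] at h0
    by_cases hyu : y = u
    · simp [hyu] at h0
    rw [if_neg hyu] at h0
    obtain ⟨h1, h2, h3, -⟩ := hun y (by simp [mem_opened, h0])
    rw [h1, h2, h3, hdist]
    exact h.fresh y hy h0
  · obtain ⟨ord, hord⟩ := h.order
    have hcard : (closed N s'.nat).card = (closed N s.nat).card + 1 := by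
      rw [hcl, Finset.card_insert_of_notMem (by simp [mem_closed, hu1])]
    refine ⟨fun y => if y = u then (closed N s.nat).card else ord y, fun y hy hy0 => ?_⟩
    rw [hcard]
    simp only [hstatus, hpred] at hy0 ⊢
    by_cases hyu : y = u
    · subst hyu
      obtain ⟨h2, h3, h4, -⟩ := hord y hy (by omega)
      refine ⟨h2, h3, h4.imp_right fun h5 => ?_, by simp⟩
      have hne : s.nat .pred y 0 ≠ y := fun he => by rw [he] at h5; omega
      have h6 := hord _ h2 (by omega)
      simp only [if_neg hne, if_true]
      exact ⟨h5.1, fun _ => h6.2.2.2 h5.1⟩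
    · simp only [if_neg hyu] at hy0 ⊢
      obtain ⟨h2, h3, h4, h5⟩ := hord y hy hy0
      refine ⟨h2, h3, h4.imp_right fun h6 => ?_, fun h7 => (h5 h7).trans (Nat.lt_succ_self _)⟩
      have hne : s.nat .pred y 0 ≠ u := fun he => by rw [he] at h6; omega
      simpa only [if_neg hne, ite_self] using h6

variable [LinearOrder W]

/-- Relaxing an edge takes amortized constant time. -/
theorem wp_relax {s : Machine W} (h : DState E N s₀ s) {u v : ℕ} (hv : v < N) (hu : u < N)
    (hE : E u v) (hus : u = s₀ ∨ s.nat .status u 0 = 2) (c : WithTop W) :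
    wp (relax N u v c) (fun _ s' => DState E N s₀ s' ∧ Frame dijArrs [.dist] s s' ∧
      closed N s'.nat = closed N s.nat ∧
      s'.time + pot N (opened N s'.nat) ∅ s'.nat ≤
        s.time + pot N (opened N s.nat) ∅ s.nat + 110) s := by
  simp only [relax, wp_bind, wp_rd, wp_rdW, wp_eqN, wp_ltW, wp_wrW, wp_wr, wp_ite, wp_pure,
    decide_eq_true_eq]
  have hsub : Heap.arrs ⊆ dijArrs := by simp [dijArrs]
  refine ⟨fun _ => ⟨⟨h.heap, h.status, h.fresh, h.order⟩, .refl s, trivial, by omega⟩,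
    fun hv2 => ⟨fun _ => ⟨fun hv0 => ?_, fun hv0 => ?_⟩,
    fun _ => ⟨⟨h.heap, h.status, h.fresh, h.order⟩, .refl s, trivial, by omega⟩⟩⟩
  · set M₂ := upd (upd s.nat .pred v 0 u) .status v 0 1 with hM₂
    have hst : ∀ y, M₂ .status y 0 = if y = v then 1 else s.nat .status y 0 :=
      fun y => by simp [hM₂, upd]
    have hpr : ∀ y, M₂ .pred y 0 = if y = v then u else s.nat .pred y 0 :=
      fun y => by simp [hM₂, upd]
    have hother : ∀ A ∈ Heap.arrs, M₂ A = s.nat A := by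
      intro A hA
      rw [hM₂, upd_of_ne, upd_of_ne] <;> rintro rfl <;> revert hA <;> decide
    have hop : opened N M₂ = insert v (opened N s.nat) := by
      ext y
      simp only [mem_opened, hst, Finset.mem_insert]
      grind
    have hvo : v ∉ opened N s.nat := by simp [mem_opened, hv0]
    obtain ⟨h1, h2, h3, -⟩ := h.fresh v hv hv0
    have hH := (h.heap.insert hvo hv h1 h2 h3).congr hother
    rw [insert_empty_eq] at hH
    have hpar : M₂ .parent = s.nat .parent := hother _ (by decide)
    have hmark : M₂ .mark = s.nat .mark := hother _ (by decide)
    refine wp_mono (wp_plant hH (by simp) (by dsimp only; rw [hpar]; exact h1)) fun _ s₁ P => ?_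
    have hH₁ := P.heap
    have ht := P.time
    rw [show ({v} : Finset ℕ).erase v = ∅ by simp] at hH₁ ht
    have hst₁ : s₁.nat .status = M₂ .status := P.frame.1 _ (by decide)
    have hpr₁ : s₁.nat .pred = M₂ .pred := P.frame.1 _ (by decide)
    have hdist : s₁.wt .dist = upd s.wt .dist v 0 c .dist := P.frame.2 _ (by simp)
    have hop₁ : opened N s₁.nat = insert v (opened N s.nat) := by
      rw [← hop]; simp only [opened, hst₁]
    refine ⟨h.relaxed hv hu hE hus hv2 (hop₁ ▸ hH₁) (fun y => by rw [hst₁, hst])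
      (fun y => by rw [hpr₁, hpr]) (fun y hy => by simp [hdist, upd, hy])
      (Untouched.trans ?_ P.untouched), Frame.trans ?_ (P.frame.mono hsub (by simp)), ?_, ?_⟩
    · intro y _
      dsimp only
      rw [hpar, hmark, hother .deg (by decide), hother .kid (by decide)]
      exact ⟨rfl, rfl, rfl, fun _ => rfl⟩
    · refine ⟨fun A hA => ?_, fun A hA => upd_of_ne (by simpa using hA)⟩
      simp only [List.mem_cons, not_or] at hA
      exact (upd_of_ne (by simp [hA])).trans (upd_of_ne (by simp [hA]))
    · ext y
      simp only [mem_closed, hst₁, hst]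
      grind
    · have h4 := Finset.card_le_card P.marked
      have h5 : (marked (insert v (opened N s.nat)) M₂).card ≤
          (marked (opened N s.nat) s.nat).card := by
        refine Finset.card_le_card fun y => ?_
        simp only [marked, Finset.mem_filter, Finset.mem_insert, hmark]
        grind
      have h6 : (roots N (insert v (opened N s.nat)) {v} M₂).card ≤
          (roots N (opened N s.nat) ∅ s.nat).card + 1 := by
        refine le_trans (Finset.card_le_card fun y => ?_) (Finset.card_insert_le v _)
        simp only [roots, Finset.mem_filter, Finset.mem_insert, hpar, Finset.mem_singleton]
        grind
      rw [hop₁]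
      dsimp only at h4 ht
      unfold pot
      omega
  · have hv1 : s.nat .status v 0 = 1 := by
      have := h.status v hv
      omega
    set M₁ := upd s.nat .pred v 0 u with hM₁
    have hpr : ∀ y, M₁ .pred y 0 = if y = v then u else s.nat .pred y 0 :=
      fun y => by simp [hM₁, upd]
    have hother : ∀ A, A ≠ .pred → M₁ A = s.nat A := fun A hA => upd_of_ne hA
    have hH := h.heap.congr (M' := M₁) fun A hA => hother A (by rintro rfl; revert hA; decide)
    have hpar : M₁ .parent = s.nat .parent := hother _ (by decide)
    have hmark : M₁ .mark = s.nat .mark := hother _ (by decide)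
    refine wp_mono (wp_decreaseKey hH (mem_opened.2 ⟨hv, hv1⟩)) ?_
    rintro _ s₁ ⟨hH₁, hfr, hun, ht⟩
    have hst₁ : s₁.nat .status = s.nat .status :=
      (hfr.1 .status (by decide)).trans (hother .status (by decide))
    have hpr₁ : s₁.nat .pred = M₁ .pred := hfr.1 _ (by decide)
    have hdist : s₁.wt .dist = upd s.wt .dist v 0 c .dist := hfr.2 _ (by simp)
    have hop₁ : opened N s₁.nat = opened N s.nat := by simp only [opened, hst₁]
    refine ⟨h.relaxed hv hu hE hus hv2 (hop₁ ▸ hH₁) (fun y => ?_)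
      (fun y => by rw [hpr₁, hpr]) (fun y hy => by simp [hdist, upd, hy])
      fun y hy => ?_, Frame.trans ?_ (hfr.mono hsub (by simp)), ?_, ?_⟩
    · rw [hst₁]
      split_ifs with hy
      · rw [hy, hv1]
      · rfl
    · have h1 := hun y fun hy' => hy (Finset.mem_insert_of_mem hy')
      dsimp only at h1
      rwa [hpar, hmark, hother .deg (by decide), hother .kid (by decide)] at h1
    · refine ⟨fun A hA => ?_, fun A hA => upd_of_ne (by simpa using hA)⟩
      simp only [List.mem_cons, not_or] at hA
      exact upd_of_ne (by simp [hA])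
    · simp only [closed, hst₁]
    · have h6 : pot N (opened N s.nat) ∅ M₁ = pot N (opened N s.nat) ∅ s.nat := by
        simp only [pot, roots, marked, hpar, hmark]
      rw [hop₁]
      dsimp only at ht
      omega

end

section

variable {W : Type}

/-- The edge relation of the graph that is stored in the arrays `g` of the memory `M`. -/
def EdgeIn (g : GraphArrays) (M : NArr → ℕ → ℕ → ℕ) (u v : ℕ) : Prop :=
  ∃ k < M g.len u 0, M g.tgt u k = v

theorem wp_extend [Add W] [LinearOrder W] (ℓ : PathLength) (x y : WithTop W) {Q : WithTop W → Machine W → Prop}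
    {s : Machine W} (h : ∀ z, Q z ⟨s.nat, s.wt, s.time + 1⟩) : wp (ℓ.extend x y) Q s := by
  cases ℓ
  · exact (wp_addW x y Q s).2 (h _)
  · exact (wp_maxW x y Q s).2 (h _)

/-- Dijkstra's algorithm halts in time `O(N log N + M)`, and its predecessors lead from every
vertex at finite distance back to the source. -/
theorem wp_dijkstra [Add W] [LinearOrder W] {g : GraphArrays} (ℓ : PathLength) {N s₀ : ℕ} {s : Machine W}
    (hlen : g.len ∉ dijArrs) (htgt : g.tgt ∉ dijArrs) (hs₀ : s₀ < N)
    (hg : ∀ u < N, ∀ k < s.nat g.len u 0, s.nat g.tgt u k < N) :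
    wp (dijkstra g ℓ N s₀) (fun _ s' => Frame dijArrs [.dist] s s' ∧
      s'.time ≤ s.time + 400 * (N * lg N + ∑ u ∈ Finset.range N, s.nat g.len u 0) ∧
      PredChain (EdgeIn g s.nat) N s₀ (fun v => s'.nat .pred v 0)
        (fun v => s'.nat .status v 0 = 2) ∧
      ∀ v < N, s'.wt .dist v 0 < ⊤ → s'.nat .status v 0 = 2) s := by
  set E := EdgeIn g s.nat with hE
  set m := ∑ u ∈ Finset.range N, s.nat g.len u 0 with hm
  have hlg : 1 ≤ lg N := by unfold lg; omega
  have hgraph : ∀ {st : Machine W}, Frame dijArrs [.dist] s st →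
      st.nat g.len = s.nat g.len ∧ st.nat g.tgt = s.nat g.tgt :=
    fun h => ⟨h.1 _ hlen, h.1 _ htgt⟩
  simp only [dijkstra, wp_bind, wp_wr]
  -- initialization
  refine wp_mono (wp_upTo (fun i st => Frame dijArrs [.dist] s st ∧
      st.time ≤ s.time + 2 + 8 * i ∧ st.nat .slots 0 0 = 0 ∧
      ∀ v < i, st.wt .dist v 0 = ⊤ ∧ st.nat .status v 0 = 0 ∧ st.nat .parent v 0 = N ∧
        st.nat .deg v 0 = 0 ∧ st.nat .mark v 0 = 0 ∧ st.nat .tab v 0 = N) ?_ ?_) ?_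
  · refine ⟨⟨fun A hA => ?_, fun _ _ => rfl⟩, by simp, by simp [upd], by simp⟩
    simp only [List.mem_cons, not_or] at hA
    exact upd_of_ne (by simp [hA])
  · rintro i st hi ⟨hfr, ht, hsl, hv⟩
    simp only [wp_bind, wp_wr, wp_wrW]
    refine ⟨hfr.trans ⟨fun A hA => ?_, fun A hA => upd_of_ne (by simpa using hA)⟩,
      by omega, by simp [upd, hsl], fun v hvi => ?_⟩
    · simp only [List.mem_cons, not_or] at hA
      funext k l
      simp [upd, hA]
    · by_cases hvi' : v = i
      · simp [upd, hvi']
      · have := hv v (by omega)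
        simp [upd, hvi', this]
  rintro _ s₁ ⟨hfr₁, ht₁, hsl, hv₁⟩
  have hop₁ : opened N s₁.nat = ∅ := by
    ext y
    simp only [mem_opened, Finset.notMem_empty, iff_false, not_and]
    intro hy
    simp [hv₁ y hy]
  have hcl₁ : closed N s₁.nat = ∅ := by
    ext y
    simp only [mem_closed, Finset.notMem_empty, iff_false, not_and]
    intro hy
    simp [hv₁ y hy]
  have hD₁ : DState E N s₀ s₁ := by
    refine ⟨?_, fun v hv => by simp [hv₁ v hv], fun v hv _ => ?_,
      fun _ => 0, fun v hv h0 => absurd (hv₁ v hv).2.1 h0⟩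
    · rw [hop₁]
      exact ⟨by simp, by simp, by simp, by simp, by simp, ⟨fun _ => 0, by simp⟩, by simp, by simp,
        fun d hd => Or.inl (hv₁ d hd).2.2.2.2.2, by simp, by simp [hsl]⟩
    · obtain ⟨h1, h2, h3, h4, h5, h6⟩ := hv₁ v hv
      exact ⟨h3, h4, h5, h1⟩
  have hpot₁ : pot N (opened N s₁.nat) ∅ s₁.nat = 0 := by
    simp [pot, hop₁, roots, marked]
  -- the edges out of the source
  obtain ⟨hlen₁, htgt₁⟩ := hgraph hfr₁
  have hls₀ : s.nat g.len s₀ 0 ≤ m :=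
    Finset.single_le_sum (f := fun u => s.nat g.len u 0) (fun _ _ => Nat.zero_le _)
      (Finset.mem_range.2 hs₀)
  simp only [wp_rd, hlen₁]
  refine wp_mono (wp_upTo (fun i st => DState E N s₀ st ∧ Frame dijArrs [.dist] s st ∧
      closed N st.nat = ∅ ∧
      st.time + pot N (opened N st.nat) ∅ st.nat ≤ s.time + 4 + 8 * N + 114 * i) ?_ ?_) ?_
  · exact ⟨⟨hD₁.heap, hD₁.status, hD₁.fresh, hD₁.order⟩, hfr₁, hcl₁, by
      dsimp only; rw [hpot₁]; omega⟩
  · rintro k st hk ⟨hD, hfr, hcl, ht⟩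
    obtain ⟨hlen', htgt'⟩ := hgraph hfr
    simp only [wp_bind, wp_rd, wp_rdW]
    have hD' : DState E N s₀ (⟨st.nat, st.wt, st.time + 1 + 1 + 1⟩ : Machine W) :=
      ⟨hD.heap, hD.status, hD.fresh, hD.order⟩
    refine wp_mono (wp_relax hD' (u := s₀) ?_ hs₀ ⟨k, hk, by rw [htgt']⟩ (Or.inl rfl) _) ?_
    · rw [htgt']
      exact hg s₀ hs₀ k hk
    · rintro _ s₂ ⟨hD₂, hfr₂, hcl₂, ht₂⟩
      exact ⟨hD₂, hfr.trans hfr₂, hcl₂.trans hcl, by dsimp only at ht₂; omega⟩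
  rintro _ s₂ ⟨hD₂, hfr₂, hcl₂, ht₂⟩
  -- the main loop
  -- the time that is set aside for the vertices which are not yet closed
  set budget : (NArr → ℕ → ℕ → ℕ) → ℕ := fun M =>
    ∑ v ∈ Finset.range N \ closed N M, (170 * lg N + 114 * s.nat g.len v 0) with hbudget
  set T := s.time + 4 + 8 * N + 114 * m + (170 * lg N * N + 114 * m) with hT
  refine wp_iter (fun _ st => DState E N s₀ st ∧ Frame dijArrs [.dist] s st ∧
      st.time + pot N (opened N st.nat) ∅ st.nat + budget st.nat ≤ T)
    (fun _ st => (Finset.range N \ closed N st.nat).card) ?_ ⟨hD₂, hfr₂, ?_⟩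
  · rintro _ st ⟨hD, hfr, ht⟩
    simp only [wp_bind]
    have hsub : Heap.arrs ⊆ dijArrs := by simp [dijArrs]
    refine wp_mono (wp_extractMin (s := ⟨st.nat, st.wt, st.time + 1⟩) hD.heap) ?_
    rintro u st' ⟨hfr', ⟨huN, hemp, hnat, ht'⟩ | ⟨huo, hH', hun, ht'⟩⟩
    · simp only [huN, wp_eqN, wp_ite, wp_pure, wp_bind, decide_eq_true_eq, not_true, false_imp_iff,
        true_imp_iff, and_true]
      dsimp only at hemp hnat ht'
      refine ⟨hfr.trans (hfr'.mono hsub (by simp)), ?_, ?_, ?_⟩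
      · have h1 : lg N * 1 ≤ lg N * N := Nat.mul_le_mul_left _ (by omega)
        have h2 : N * 1 ≤ N * lg N := Nat.mul_le_mul_left _ hlg
        have h3 : lg N * N = N * lg N := Nat.mul_comm _ _
        rw [Nat.mul_assoc] at hT
        omega
      · obtain ⟨ord, hord⟩ := hD.order
        rw [hnat]
        refine ⟨ord, fun v hv hv2 => ?_⟩
        obtain ⟨h1, h2, h3, h4⟩ := hord v hv (by omega)
        have h5 : (closed N st.nat).card ≤ N := by
          simpa [closed] using Finset.card_le_card (Finset.filter_subset
            (fun v => st.nat .status v 0 = 2) (Finset.range N))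
        exact ⟨(h4 hv2).trans_le h5, h1, h2, h3.imp_right fun h6 => ⟨h6.1, h6.2 hv2⟩⟩
      · intro v hv hd
        have hwt : st'.wt .dist v 0 = st.wt .dist v 0 := by rw [hfr'.2 _ (by simp)]
        rw [hwt] at hd
        rw [hnat]
        have h1 := hD.status v hv
        have h2 : v ∉ opened N st.nat := by rw [hemp]; simp
        have h3 : st.nat .status v 0 ≠ 1 := fun h => h2 (mem_opened.2 ⟨hv, h⟩)
        have h4 : st.nat .status v 0 ≠ 0 := fun h => by
          rw [(hD.fresh v hv h).2.2.2] at hd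
          exact lt_irrefl _ hd
        omega
    · obtain ⟨huN, hu1⟩ := mem_opened.1 huo
      simp only [wp_eqN, wp_ite, wp_pure, wp_bind, decide_eq_true_eq, wp_wr, wp_rd, wp_rdW]
      refine ⟨fun h => absurd h huN.ne, fun _ => ?_⟩
      dsimp only at hun ht' huo hH'
      set M₃ := upd st'.nat .status u 0 2 with hM₃
      have hst' : st'.nat .status = st.nat .status := hfr'.1 _ (by decide)
      have hst₃ : ∀ y, M₃ .status y 0 = if y = u then 2 else st.nat .status y 0 :=
        fun y => by simp [hM₃, upd, hst']
      have hM₃other : ∀ A, A ≠ .status → M₃ A = st'.nat A := fun A hA => upd_of_ne hA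
      obtain ⟨hD₃, hop₃, hcl₃⟩ := hD.close (s' := ⟨M₃, st'.wt, st'.time + 4⟩) huo
        (hH'.congr fun A hA => hM₃other A (by rintro rfl; revert hA; decide)) hst₃
        ((hM₃other .pred (by decide)).trans (hfr'.1 .pred (by decide)))
        (funext fun A => hfr'.2 A (by simp))
        (hun.trans fun y _ => by
          dsimp only
          rw [hM₃other .parent (by decide), hM₃other .deg (by decide),
            hM₃other .mark (by decide), hM₃other .kid (by decide)]
          exact ⟨rfl, rfl, rfl, fun _ => rfl⟩)
      dsimp only at hop₃ hcl₃
      have hpot₃ : pot N (opened N M₃) ∅ M₃ = pot N ((opened N st.nat).erase u) ∅ st'.nat := by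
        simp only [pot, roots, marked, hop₃, hM₃other .parent (by decide),
          hM₃other .mark (by decide)]
      have hfr₃ : Frame dijArrs [.dist] s ⟨M₃, st'.wt, st'.time + 4⟩ := by
        refine (hfr.trans (Frame.trans ?_ (hfr'.mono hsub (by simp)))).trans
          ⟨fun A hA => ?_, fun _ _ => rfl⟩
        · exact ⟨fun _ _ => rfl, fun _ _ => rfl⟩
        · simp only [List.mem_cons, not_or] at hA
          exact upd_of_ne hA.1
      have hlen₃ : M₃ g.len = s.nat g.len := (hgraph hfr₃).1
      have huc : u ∈ Finset.range N \ closed N st.nat := by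
        simp [mem_closed, huN, hu1]
      have hdiff : Finset.range N \ closed N M₃ = (Finset.range N \ closed N st.nat).erase u := by
        rw [hcl₃]
        ext y
        simp only [Finset.mem_sdiff, Finset.mem_insert, Finset.mem_erase]
        tauto
      have hbud : budget M₃ + (170 * lg N + 114 * s.nat g.len u 0) = budget st.nat := by
        simp only [hbudget, hdiff]
        exact Finset.sum_erase_add _ _ huc
      simp only [hlen₃]
      refine wp_mono (wp_upTo (fun i st₄ => DState E N s₀ st₄ ∧ Frame dijArrs [.dist] s st₄ ∧
        closed N st₄.nat = closed N M₃ ∧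
        st₄.time + pot N (opened N st₄.nat) ∅ st₄.nat ≤
          st'.time + 5 + pot N (opened N M₃) ∅ M₃ + 114 * i) ?_ ?_) ?_
      · exact ⟨⟨hD₃.heap, hD₃.status, hD₃.fresh, hD₃.order⟩, hfr₃, rfl, by dsimp only; omega⟩
      · rintro k st₄ hk ⟨hD₄, hfr₄, hcl₄, ht₄⟩
        obtain ⟨hlen', htgt'⟩ := hgraph hfr₄
        simp only [wp_bind, wp_rd, wp_rdW]
        refine wp_extend ℓ _ _ fun z => ?_
        have hD' : DState E N s₀
            (⟨st₄.nat, st₄.wt, st₄.time + 1 + 1 + 1 + 1⟩ : Machine W) :=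
          ⟨hD₄.heap, hD₄.status, hD₄.fresh, hD₄.order⟩
        refine wp_mono (wp_relax hD' (u := u) ?_ huN ⟨k, hk, by rw [htgt']⟩ (Or.inr ?_) _) ?_
        · rw [htgt']
          exact hg u huN k hk
        · have h5 : u ∈ closed N st₄.nat := by rw [hcl₄, hcl₃]; simp
          exact (mem_closed.1 h5).2
        · rintro _ s₅ ⟨hD₅, hfr₅, hcl₅, ht₅⟩
          exact ⟨hD₅, hfr₄.trans hfr₅, hcl₅.trans hcl₄, by dsimp only at ht₅; omega⟩
      · rintro _ s₅ ⟨hD₅, hfr₅, hcl₅, ht₅⟩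
        have hbud₅ : budget s₅.nat = budget M₃ := by simp only [hbudget, hcl₅]
        refine ⟨⟨hD₅, hfr₅, ?_⟩, ?_⟩
        · rw [hbud₅]
          rw [hpot₃] at ht₅
          omega
        · rw [hcl₅, hdiff]
          exact Finset.card_erase_lt_of_mem huc
  · have : budget s₂.nat = 170 * lg N * N + 114 * m := by
      simp only [hbudget, hcl₂, Finset.sdiff_empty, Finset.sum_add_distrib, Finset.sum_const,
        Finset.card_range, smul_eq_mul, ← Finset.mul_sum]
      rw [Nat.mul_comm N]
    rw [this]
    omega

end

/-! ### Distance matrices and predecessor matrices -/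

/-- A row of a distance matrix (`d`, with columns for the vertices `B 0, …, B (b - 1)`) and of
a predecessor matrix (`pr`) for the source `s₀`: wherever the distance is finite, the predecessors
lead back to `s₀`. -/
def Row {R : Type} [LT R] (E : ℕ → ℕ → Prop) (N s₀ : ℕ) (pr : ℕ → ℕ) (B : ℕ → ℕ → ℕ) (b : ℕ)
    (d : ℕ → WithTop R) : Prop :=
  ∃ reach, PredChain E N s₀ pr reach ∧ ∀ j < b, d j < ⊤ → reach (B j 0)

theorem PredChain.congr {E : ℕ → ℕ → Prop} {N s₀ : ℕ} {pr pr' : ℕ → ℕ} {reach : ℕ → Prop}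
    (h : PredChain E N s₀ pr reach) (hpr : ∀ v < N, pr' v = pr v) :
    PredChain E N s₀ pr' reach := by
  obtain ⟨ord, hord⟩ := h
  refine ⟨ord, fun v hv hr => ?_⟩
  rw [hpr v hv]
  exact hord v hv hr

section

variable {W : Type}

theorem wp_shortestPath [Add W] [LinearOrder W] {g : GraphArrays} (ℓ : PathLength) {N a b : ℕ}
    {A B : NArr} {Dm : WArr} {Pm : NArr} {s : Machine W}
    (hlen : g.len ∉ Pm :: dijArrs) (htgt : g.tgt ∉ Pm :: dijArrs) (hPm : Pm ∉ dijArrs)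
    (hA : A ∉ Pm :: dijArrs) (hB : B ∉ Pm :: dijArrs) (hDm : Dm ≠ .dist)
    (hAN : ∀ i < a, s.nat A i 0 < N) (hBN : ∀ j < b, s.nat B j 0 < N)
    (hg : ∀ u < N, ∀ k < s.nat g.len u 0, s.nat g.tgt u k < N) :
    wp (shortestPath g ℓ N A a B b Dm Pm) (fun _ s' =>
      Frame (Pm :: dijArrs) [Dm, .dist] s s' ∧
      s'.time ≤ s.time + 1 +
        a * (407 * (N * lg N + ∑ u ∈ Finset.range N, s.nat g.len u 0) + 4 * b) ∧
      ∀ i < a, Row (EdgeIn g s.nat) N (s.nat A i 0) (s'.nat Pm i) (s.nat B) b (s'.wt Dm i)) s := by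
  have hlg : 1 ≤ lg N := by unfold lg; omega
  unfold shortestPath
  refine wp_mono (wp_upTo (fun i st => Frame (Pm :: dijArrs) [Dm, .dist] s st ∧
      st.time ≤ s.time + 1 +
        i * (407 * (N * lg N + ∑ u ∈ Finset.range N, s.nat g.len u 0) + 4 * b) ∧
      ∀ i' < i, Row (EdgeIn g s.nat) N (s.nat A i' 0) (st.nat Pm i') (s.nat B) b
        (st.wt Dm i')) ?_ ?_) (fun _ _ h => h)
  · exact ⟨⟨fun _ _ => rfl, fun _ _ => rfl⟩, by simp, by simp⟩
  rintro i st hi ⟨hfr, ht, hrow⟩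
  have hlen' : st.nat g.len = s.nat g.len := hfr.1 _ hlen
  have htgt' : st.nat g.tgt = s.nat g.tgt := hfr.1 _ htgt
  have hA' : st.nat A = s.nat A := hfr.1 _ hA
  have hE : EdgeIn g st.nat = EdgeIn g s.nat := by unfold EdgeIn; rw [hlen', htgt']
  simp only [wp_bind, wp_rd, hA']
  refine wp_mono (wp_dijkstra ℓ (fun h => hlen (.tail _ h)) (fun h => htgt (.tail _ h))
    (hAN i hi) ?_) ?_
  · simp only [hlen', htgt']
    exact hg
  simp only [hlen', hE]
  rintro _ s₁ ⟨hfr₁, ht₁, hchain, hdist⟩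
  have hfr₁' : Frame (Pm :: dijArrs) [Dm, .dist] s s₁ := hfr.trans <| by
    refine Frame.trans ?_ (hfr₁.mono (List.subset_cons_self _ _) (List.subset_cons_self _ _))
    exact ⟨fun _ _ => rfl, fun _ _ => rfl⟩
  have hD₁ : s₁.wt Dm = st.wt Dm := hfr₁.2 _ (by simpa using hDm)
  have hP₁ : s₁.nat Pm = st.nat Pm := hfr₁.1 _ hPm
  have hB₁ : s₁.nat B = s.nat B := hfr₁'.1 _ hB
  refine wp_mono (wp_upTo (fun j s₂ => s₂.nat = s₁.nat ∧ (∀ A, A ≠ Dm → s₂.wt A = s₁.wt A) ∧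
      s₂.time ≤ s₁.time + 1 + 4 * j ∧ (∀ i', i' ≠ i → s₂.wt Dm i' = st.wt Dm i') ∧
      ∀ l < j, s₂.wt Dm i l = s₁.wt .dist (s.nat B l 0) 0) ?_ ?_) ?_
  · exact ⟨rfl, fun _ _ => rfl, by simp, fun i' _ => by simp only [hD₁], by simp⟩
  · rintro j s₂ hj ⟨hn, hw, ht₂, h1, h2⟩
    simp only [wp_bind, wp_rd, wp_rdW, wp_wrW2, hn, hB₁, hw _ hDm.symm]
    refine ⟨trivial, fun A hA => (upd_of_ne hA).trans (hw A hA), by omega, fun i' hi' => ?_,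
      fun l hl => ?_⟩
    · rw [← h1 i' hi']
      funext l
      simp [upd, hi']
    · by_cases hlj : l = j
      · simp [upd, hlj]
      · simp only [upd, hlj, and_false, if_false]
        exact h2 l (by omega)
  rintro _ s₂ ⟨hn₂, hw₂, ht₂, hrow₂, hcol₂⟩
  refine wp_mono (wp_upTo (fun v s₃ => s₃.wt = s₂.wt ∧ (∀ A, A ≠ Pm → s₃.nat A = s₁.nat A) ∧
      s₃.time ≤ s₂.time + 1 + 3 * v ∧ (∀ i', i' ≠ i → s₃.nat Pm i' = st.nat Pm i') ∧
      ∀ l < v, s₃.nat Pm i l = s₁.nat .pred l 0) ?_ ?_) ?_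
  · exact ⟨rfl, fun A _ => by rw [← hn₂], by simp, fun i' _ => by simp only [hn₂, hP₁], by simp⟩
  · rintro v s₃ hv ⟨hw, hn, ht₃, h1, h2⟩
    have hpred : s₃.nat .pred = s₁.nat .pred := hn _ (fun h => hPm (by simp [← h]))
    simp only [wp_bind, wp_rd, wp_wr2, hpred]
    refine ⟨hw, fun A hA => (upd_of_ne hA).trans (hn A hA), by omega, fun i' hi' => ?_,
      fun l hl => ?_⟩
    · rw [← h1 i' hi']
      funext l
      simp [upd, hi']
    · by_cases hlv : l = v
      · simp [upd, hlv]
      · simp only [upd, hlv, and_false, if_false]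
        exact h2 l (by omega)
  rintro _ s₃ ⟨hw₃, hn₃, ht₃, hrow₃, hcol₃⟩
  refine ⟨hfr₁'.trans ⟨fun A hA => hn₃ A (by simp_all), fun A hA => ?_⟩, ?_, fun i' hi' => ?_⟩
  · rw [hw₃]
    exact hw₂ A (by simp_all)
  · have h1 : N * 1 ≤ N * lg N := Nat.mul_le_mul_left _ hlg
    have h2 := hAN i hi
    rw [Nat.add_mul, Nat.one_mul]
    omega
  · by_cases hii : i' = i
    · subst hii
      refine ⟨_, hchain.congr fun v hv => hcol₃ v hv, fun j hj hd => ?_⟩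
      rw [hw₃, hcol₂ j hj] at hd
      exact hdist _ (hBN j hj) hd
    · rw [hrow₃ i' hii, hw₃, hrow₂ i' hii]
      exact hrow i' (by omega)

/-! ### The graph `G_S` and the search for the best triple -/

/-- The edges of the graph `G_S` have finite weight `D`. -/
theorem wp_buildGraphS [LinearOrder W] (nS : ℕ) (s : Machine W) :
    wp (buildGraphS nS) (fun _ s' => Frame [.idS, .lenS, .tgtS] [.wtS] s s' ∧
      s'.time ≤ s.time + 1 + nS * (4 + 8 * nS) ∧
      ∀ i < nS, s'.nat .idS i 0 = i ∧ s'.nat .lenS i 0 ≤ nS ∧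
        ∀ k < s'.nat .lenS i 0, s'.nat .tgtS i k < nS ∧
          s.wt .D i (s'.nat .tgtS i k) < ⊤) s := by
  unfold buildGraphS
  refine wp_mono (wp_upTo (fun i st => Frame [.idS, .lenS, .tgtS] [.wtS] s st ∧
      st.time ≤ s.time + 1 + i * (4 + 8 * nS) ∧
      ∀ i' < i, st.nat .idS i' 0 = i' ∧ st.nat .lenS i' 0 ≤ nS ∧
        ∀ k < st.nat .lenS i' 0, st.nat .tgtS i' k < nS ∧
          s.wt .D i' (st.nat .tgtS i' k) < ⊤) ?_ ?_) (fun _ _ h => h)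
  · exact ⟨⟨fun _ _ => rfl, fun _ _ => rfl⟩, by simp, by simp⟩
  rintro i st hi ⟨hfr, ht, hrow⟩
  simp only [wp_bind, wp_wr]
  refine wp_mono (wp_upTo (fun j st' => Frame [.idS, .lenS, .tgtS] [.wtS] s st' ∧
      st'.time ≤ s.time + 1 + i * (4 + 8 * nS) + 4 + 8 * j ∧
      (∀ i' < i + 1, st'.nat .idS i' 0 = i' ∧ st'.nat .lenS i' 0 ≤ nS ∧
        ∀ k < st'.nat .lenS i' 0, st'.nat .tgtS i' k < nS ∧
          s.wt .D i' (st'.nat .tgtS i' k) < ⊤) ∧ st'.nat .lenS i 0 ≤ j) ?_ ?_) ?_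
  · refine ⟨hfr.trans ⟨fun A hA => ?_, fun _ _ => rfl⟩, by dsimp only; omega, fun i' hi' => ?_,
      by simp [upd]⟩
    · simp only [List.mem_cons, not_or] at hA
      exact (upd_of_ne hA.2.1).trans (upd_of_ne hA.1)
    · by_cases hii : i' = i
      · simp [upd, hii]
      · simpa [upd, hii] using hrow i' (by omega)
  · rintro j s₁ hj ⟨hfr₁, ht₁, hrow₁, hl⟩
    have hD : s₁.wt .D = s.wt .D := hfr₁.2 _ (by decide)
    simp only [wp_bind, wp_rdW, wp_ltW, wp_ite, wp_rd, wp_wr2, wp_wrW2, wp_addN, wp_wr, wp_pure,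
      decide_eq_true_eq, hD]
    refine ⟨fun hx => ⟨hfr₁.trans ⟨fun A hA => ?_, fun A hA => upd_of_ne (by simpa using hA)⟩,
      by omega, fun i' hi' => ?_, by simp [upd]; omega⟩,
      fun _ => ⟨hfr₁.trans ⟨fun _ _ => rfl, fun _ _ => rfl⟩, by omega, hrow₁, by omega⟩⟩
    · simp only [List.mem_cons, not_or] at hA
      exact (upd_of_ne hA.2.1).trans (upd_of_ne hA.2.2.1)
    · have h1 := hrow₁ i' hi'
      by_cases hii : i' = i
      · subst hii
        refine ⟨by simpa [upd] using h1.1, by simp [upd]; omega, fun k hk => ?_⟩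
        simp only [upd, true_and, and_self, if_true] at hk
        by_cases hkl : k = s₁.nat .lenS i' 0
        · simp [upd, hkl, hj, hx]
        · simpa [upd, hkl] using h1.2.2 k (by omega)
      · simpa [upd, hii] using h1
  · rintro _ s₁ ⟨hfr₁, ht₁, hrow₁, -⟩
    exact ⟨hfr₁, by rw [Nat.add_mul, Nat.one_mul]; omega, hrow₁⟩

theorem wp_zeroEntries [Zero W] (nF nS : ℕ) (s : Machine W) :
    wp (zeroEntries nF nS) (fun _ s' => Frame [] [.DFS, .DSF] s s' ∧
      s'.time ≤ s.time + 1 + nF * (2 + 6 * nS) ∧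
      ∀ i j, s.nat .listF i 0 ≠ s.nat .listS j 0 →
        s'.wt .DFS i j = s.wt .DFS i j ∧ s'.wt .DSF j i = s.wt .DSF j i) s := by
  unfold zeroEntries
  refine wp_mono (wp_upTo (fun i' st => Frame [] [.DFS, .DSF] s st ∧
      st.time ≤ s.time + 1 + i' * (2 + 6 * nS) ∧
      ∀ i j, s.nat .listF i 0 ≠ s.nat .listS j 0 →
        st.wt .DFS i j = s.wt .DFS i j ∧ st.wt .DSF j i = s.wt .DSF j i) ?_ ?_)
    (fun _ _ h => h)
  · exact ⟨⟨fun _ _ => rfl, fun _ _ => rfl⟩, by simp, fun _ _ _ => ⟨rfl, rfl⟩⟩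
  rintro i' st hi ⟨hfr, ht, hent⟩
  refine wp_mono (wp_upTo (fun j' st => Frame [] [.DFS, .DSF] s st ∧
      st.time ≤ s.time + 1 + i' * (2 + 6 * nS) + 2 + 6 * j' ∧
      ∀ i j, s.nat .listF i 0 ≠ s.nat .listS j 0 →
        st.wt .DFS i j = s.wt .DFS i j ∧ st.wt .DSF j i = s.wt .DSF j i) ?_ ?_) ?_
  · exact ⟨⟨hfr.1, hfr.2⟩, by dsimp only; omega, hent⟩
  · rintro j' s₁ hj ⟨hfr₁, ht₁, hent₁⟩
    have hF : s₁.nat .listF = s.nat .listF := hfr₁.1 _ (by simp)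
    have hS : s₁.nat .listS = s.nat .listS := hfr₁.1 _ (by simp)
    simp only [wp_bind, wp_rd, wp_eqN, wp_ite, wp_wrW2, wp_pure, decide_eq_true_eq, hF, hS]
    refine ⟨fun he => ⟨hfr₁.trans ⟨fun _ _ => rfl, fun A hA => ?_⟩, by omega,
      fun i j hij => ?_⟩, fun _ => ⟨⟨hfr₁.1, hfr₁.2⟩, by omega, hent₁⟩⟩
    · simp only [List.mem_cons, not_or] at hA
      exact (upd_of_ne hA.2.1).trans (upd_of_ne hA.1)
    · have hne : ¬ (i = i' ∧ j = j') := by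
        rintro ⟨rfl, rfl⟩
        exact hij he
      have hne' : ¬ (j = j' ∧ i = i') := fun h => hne h.symm
      simpa [upd, hne, hne'] using hent₁ i j hij
  · rintro _ s₁ ⟨hfr₁, ht₁, hent₁⟩
    exact ⟨hfr₁, by rw [Nat.add_mul, Nat.one_mul]; omega, hent₁⟩

/-- The cost of the triple `(F_i, S_j, S_k)` is finite. -/
def FiniteCost [LT W] (s : Machine W) (i j k : ℕ) : Prop :=
  s.wt .DFS i j < ⊤ ∧ s.wt .DSF k i < ⊤ ∧
    ((j = k → s.nat .listF i 0 = s.nat .listS j 0) → s.wt .Dbot j k < ⊤)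

theorem wp_tripleCost [Add W] [LinearOrder W] (i j k : ℕ) (s : Machine W) :
    wp (tripleCost i j k) (fun c s' => ∃ t ≤ s.time + 9, s' = ⟨s.nat, s.wt, t⟩ ∧
      (c < ⊤ → FiniteCost s i j k)) s := by
  simp only [tripleCost, wp_bind, wp_rd, wp_rdW, wp_addW, wp_eqN, wp_ite, wp_maxW, wp_pure,
    decide_eq_true_eq]
  have hadd : s.wt .DFS i j + s.wt .DSF k i < ⊤ → s.wt .DFS i j < ⊤ ∧ s.wt .DSF k i < ⊤ :=
    fun h => WithTop.add_lt_top.1 h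
  refine ⟨fun hjk => ⟨fun hf => ⟨_, by omega, rfl, fun hc => ?_⟩,
    fun hf => ⟨_, by omega, rfl, fun hc => ?_⟩⟩, fun hjk => ⟨_, by omega, rfl, fun hc => ?_⟩⟩
  · obtain ⟨h1, h2⟩ := max_lt_iff.1 hc
    exact ⟨(hadd h1).1, (hadd h1).2, fun _ => h2⟩
  · exact ⟨(hadd hc).1, (hadd hc).2, fun h => absurd (h hjk) hf⟩
  · obtain ⟨h1, h2⟩ := max_lt_iff.1 hc
    exact ⟨(hadd h1).1, (hadd h1).2, fun _ => h2⟩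

theorem wp_findBest [Add W] [LinearOrder W] (nF nS : ℕ) (s : Machine W) :
    wp (findBest nF nS) (fun _ s' => Frame [.best] [.bestC] s s' ∧
      s'.time ≤ s.time + 2 + nF * (2 + nS * (2 + 16 * nS)) ∧
      (s'.wt .bestC 0 0 < ⊤ → s'.nat .best 0 0 < nF ∧ s'.nat .best 1 0 < nS ∧
        s'.nat .best 2 0 < nS ∧
        FiniteCost s (s'.nat .best 0 0) (s'.nat .best 1 0) (s'.nat .best 2 0))) s := by
  set I : ℕ → Machine W → Prop := fun t s' => Frame [.best] [.bestC] s s' ∧ s'.time ≤ t ∧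
    (s'.wt .bestC 0 0 < ⊤ → s'.nat .best 0 0 < nF ∧ s'.nat .best 1 0 < nS ∧
        s'.nat .best 2 0 < nS ∧
        FiniteCost s (s'.nat .best 0 0) (s'.nat .best 1 0) (s'.nat .best 2 0)) with hI
  have htick : ∀ {t : ℕ} {s' : Machine W}, I t s' → I (t + 1) ⟨s'.nat, s'.wt, s'.time + 1⟩ :=
    fun h => ⟨⟨h.1.1, h.1.2⟩, Nat.succ_le_succ h.2.1, h.2.2⟩
  have hmono : ∀ {t t' : ℕ} {s' : Machine W}, I t s' → t ≤ t' → I t' s' :=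
    fun h ht => ⟨h.1, h.2.1.trans ht, h.2.2⟩
  simp only [findBest, wp_bind, wp_wrW]
  refine wp_mono (wp_upTo (fun i => I (s.time + 2 + i * (2 + nS * (2 + 16 * nS)))) ?_ ?_)
    (fun _ _ h => h)
  · exact ⟨⟨fun _ _ => rfl, fun A hA => upd_of_ne (by simpa using hA)⟩, by simp,
      by simp [upd]⟩
  intro i st hi hst
  refine wp_mono (wp_upTo (fun j => I (s.time + 2 + i * (2 + nS * (2 + 16 * nS)) + 2 +
    j * (2 + 16 * nS))) ?_ ?_) ?_
  · exact hmono (htick (htick hst)) (by simp)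
  · intro j st hj hst
    refine wp_mono (wp_upTo (fun k => I (s.time + 2 + i * (2 + nS * (2 + 16 * nS)) + 2 +
      j * (2 + 16 * nS) + 2 + 16 * k)) ?_ ?_) ?_
    · exact hmono (htick (htick hst)) (by simp)
    · intro k st hk hst
      simp only [wp_bind]
      refine wp_mono (wp_tripleCost i j k _) ?_
      rintro c _ ⟨t, ht, rfl, hc⟩
      obtain ⟨hfr, ht', hbest⟩ := hst
      simp only [wp_rdW, wp_ltW, wp_ite, wp_wrW, wp_wr, wp_pure, wp_bind, decide_eq_true_eq]
      dsimp only at ht hc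
      refine ⟨fun hlt => ⟨hfr.trans ⟨fun A hA => ?_, fun A hA => upd_of_ne (by simpa using hA)⟩,
        by dsimp only; omega, fun hct => ?_⟩,
        fun _ => ⟨⟨hfr.1, hfr.2⟩, by dsimp only; omega, hbest⟩⟩
      · simp only [List.mem_cons, List.not_mem_nil, or_false] at hA
        exact ((upd_of_ne hA).trans (upd_of_ne hA)).trans (upd_of_ne hA)
      · obtain ⟨h1, h2, h3⟩ := hc (hlt.trans_le le_top)
        rw [hfr.2 _ (by decide)] at h1 h2 h3
        dsimp only at h3
        rw [hfr.1 _ (by decide), hfr.1 _ (by decide)] at h3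
        simpa [upd, FiniteCost, hi, hj, hk] using ⟨h1, h2, h3⟩
    · intro _ st hst
      exact hmono hst (by rw [Nat.add_mul, Nat.one_mul]; omega)
  · intro _ st hst
    exact hmono hst (by rw [Nat.add_mul i, Nat.one_mul]; omega)

end

/-! ### Extraction of the cycle -/

section

variable {W : Type}

/-- In the transition from `s` to `s'` at most `a` vertices are appended to the list `rev`, in time
at most `t`, and nothing else changes. -/
def Emitted (a t : ℕ) (s s' : Machine W) : Prop :=
  Frame [.rev, .revLen] [] s s' ∧ s'.nat .revLen 0 0 ≤ s.nat .revLen 0 0 + a ∧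
    s'.time ≤ s.time + t

theorem Emitted.refl (s : Machine W) : Emitted 0 0 s s := ⟨.refl s, le_rfl, le_rfl⟩

theorem Emitted.tick {t : ℕ} (s : Machine W) {t' : ℕ} (ht : t' ≤ s.time + t) :
    Emitted 0 t s ⟨s.nat, s.wt, t'⟩ :=
  ⟨⟨fun _ _ => rfl, fun _ _ => rfl⟩, le_rfl, ht⟩

theorem Emitted.trans {a a' t t' : ℕ} {s s' s'' : Machine W} (h : Emitted a t s s')
    (h' : Emitted a' t' s' s'') : Emitted (a + a') (t + t') s s'' := by
  obtain ⟨h1, h2, h3⟩ := h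
  obtain ⟨h1', h2', h3'⟩ := h'
  exact ⟨h1.trans h1', by omega, by omega⟩

theorem Emitted.mono {a a' t t' : ℕ} {s s' : Machine W} (h : Emitted a t s s')
    (ha : a ≤ a') (ht : t ≤ t') : Emitted a' t' s s' :=
  ⟨h.1, by have := h.2.1; omega, by have := h.2.2; omega⟩

theorem Emitted.nat_eq {a t : ℕ} {s s' : Machine W} (h : Emitted a t s s') {A : NArr}
    (hA : A ∉ [NArr.rev, .revLen]) : s'.nat A = s.nat A := h.1.1 A hA

theorem wp_emit (x : ℕ) (s : Machine W) :
    wp (emit x) (fun _ s' => Emitted 1 4 s s') s := by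
  simp only [emit, wp_bind, wp_rd, wp_wr, wp_addN]
  refine ⟨⟨fun A hA => ?_, fun _ _ => rfl⟩, by simp [upd], by simp⟩
  simp only [List.mem_cons, not_or] at hA
  exact (upd_of_ne hA.2.1).trans (upd_of_ne hA.1)

/-- Every round of the loop moves to a vertex with a smaller number in `PredChain`. -/
theorem wp_trace {E : ℕ → ℕ → Prop} {N i u t : ℕ} {Pm : NArr} {reach : ℕ → Prop}
    {s : Machine W} (hPm : Pm ∉ [NArr.rev, .revLen])
    (h : PredChain E N u (s.nat Pm i) reach) (ht : t < N) (hr : reach t) :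
    wp (trace Pm i u t) (fun _ s' => Emitted N (7 * N) s s') s := by
  obtain ⟨ord, hord⟩ := h
  refine wp_iter (fun y st => y < N ∧ reach y ∧
    ∃ k, k + (ord y + 1) ≤ N ∧ Emitted k (7 * k) s st) (fun y _ => ord y) ?_
    ⟨ht, hr, 0, by have := (hord t ht hr).1; omega, .refl s⟩
  rintro y st ⟨hy, hry, k, hk, hem⟩
  obtain ⟨-, h1, -, h2⟩ := hord y hy hry
  simp only [wp_bind, wp_rd, hem.nat_eq hPm]
  refine wp_mono (wp_emit _ _) fun _ s₁ h₁ => ?_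
  have h₂ : Emitted (k + 1) (7 * k + 6) s s₁ :=
    (hem.trans ((Emitted.tick st (t := 2) le_rfl).trans h₁)).mono (by omega) (by omega)
  simp only [wp_eqN, wp_ite, wp_pure, decide_eq_true_eq]
  refine ⟨fun _ => (h₂.trans (.tick s₁ (t := 1) le_rfl)).mono (by omega) (by omega),
    fun hne => ?_⟩
  obtain h3 | ⟨h3, h4⟩ := h2
  · exact absurd h3 hne
  · exact ⟨⟨h1, h3, k + 1, by omega,
      (h₂.trans (.tick s₁ (t := 1) le_rfl)).mono (by omega) (by omega)⟩, h4⟩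

/-- The outer path has at most `nS` edges, and each of them is replaced by at most `n` vertices. -/
theorem wp_traceBot {E E' : ℕ → ℕ → Prop} {n nS j k : ℕ} {reach : ℕ → Prop} {s : Machine W}
    (h : PredChain E nS j (s.nat .Pbot j) reach) (hk : k < nS) (hr : reach k)
    (hP : ∀ a < nS, ∀ b < nS, E a b → ∃ reach',
      PredChain E' n (s.nat .listS a 0) (s.nat .P a) reach' ∧ reach' (s.nat .listS b 0))
    (hS : ∀ a < nS, s.nat .listS a 0 < n) :
    wp (traceBot j k) (fun _ s' => Emitted (nS * n) (nS * (7 * n + 5)) s s') s := by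
  obtain ⟨ord, hord⟩ := h
  refine wp_iter (fun y st => y < nS ∧ reach y ∧
    ∃ k, k + (ord y + 1) ≤ nS ∧ Emitted (k * n) (k * (7 * n + 5)) s st) (fun y _ => ord y) ?_
    ⟨hk, hr, 0, by have := (hord k hk hr).1; omega, by simpa using Emitted.refl s⟩
  rintro y st ⟨hy, hry, l, hl, hem⟩
  obtain ⟨-, h1, hE, h2⟩ := hord y hy hry
  have hSe : st.nat .listS = s.nat .listS := hem.nat_eq (by decide)
  have hPe : st.nat .P = s.nat .P := hem.nat_eq (by decide)
  have hBe : st.nat .Pbot = s.nat .Pbot := hem.nat_eq (by decide)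
  obtain ⟨reach', hc, hr'⟩ := hP _ h1 _ hy hE
  simp only [wp_bind, wp_rd, hSe, hBe]
  refine wp_mono (wp_trace (by decide) (by dsimp only; rw [hPe]; exact hc) (hS y hy) hr')
    fun _ s₁ h₁ => ?_
  simp only [wp_eqN, wp_ite, wp_pure, decide_eq_true_eq]
  have h₂ : Emitted ((l + 1) * n) ((l + 1) * (7 * n + 5)) s ⟨s₁.nat, s₁.wt, s₁.time + 1⟩ :=
    ((hem.trans ((Emitted.tick st (t := 4) le_rfl).trans h₁)).trans
      (.tick s₁ (t := 1) le_rfl)).mono (by rw [Nat.add_mul]; omega)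
      (by rw [Nat.add_mul l]; omega)
  refine ⟨fun _ => h₂.mono (Nat.mul_le_mul_right _ (by omega)) (Nat.mul_le_mul_right _ (by omega)),
    fun hne => ?_⟩
  obtain h3 | ⟨h3, h4⟩ := h2
  · exact absurd h3 hne
  · exact ⟨⟨h1, h3, l + 1, by omega, h₂⟩, h4⟩

/-- The paths that `extractCycle` follows exist. -/
structure Traceable (n nS : ℕ) (s : Machine W) : Prop where
  listF : s.nat .listF (s.nat .best 0 0) 0 < n
  listS : ∀ a < nS, s.nat .listS a 0 < n
  best : s.nat .best 1 0 < nS ∧ s.nat .best 2 0 < nS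
  toF : s.nat .listF (s.nat .best 0 0) 0 ≠ s.nat .listS (s.nat .best 2 0) 0 →
    ∃ E reach, PredChain E n (s.nat .listS (s.nat .best 2 0) 0) (s.nat .PSF (s.nat .best 2 0))
      reach ∧ reach (s.nat .listF (s.nat .best 0 0) 0)
  toS : s.nat .listF (s.nat .best 0 0) 0 ≠ s.nat .listS (s.nat .best 1 0) 0 →
    ∃ E reach, PredChain E n (s.nat .listF (s.nat .best 0 0) 0) (s.nat .PFS (s.nat .best 0 0))
      reach ∧ reach (s.nat .listS (s.nat .best 1 0) 0)
  bot : (s.nat .best 1 0 = s.nat .best 2 0 →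
      s.nat .listF (s.nat .best 0 0) 0 = s.nat .listS (s.nat .best 1 0) 0) →
    ∃ E reach, PredChain E nS (s.nat .best 1 0) (s.nat .Pbot (s.nat .best 1 0)) reach ∧
      reach (s.nat .best 2 0) ∧
      ∀ a < nS, ∀ b < nS, E a b → ∃ E' reach', PredChain E' n (s.nat .listS a 0) (s.nat .P a)
        reach' ∧ reach' (s.nat .listS b 0)

theorem wp_extractCycle {n nS : ℕ} {s : Machine W} (h : Traceable n nS s) :
    wp extractCycle (fun _ s' => s'.time ≤ s.time + 100 * (nS * n + 1)) s := by
  obtain ⟨hfn, hSn, ⟨hj, hk⟩, htoF, htoS, hbot⟩ := h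
  obtain ⟨i, hi⟩ : ∃ i, s.nat .best 0 0 = i := ⟨_, rfl⟩
  obtain ⟨j, hj'⟩ : ∃ j, s.nat .best 1 0 = j := ⟨_, rfl⟩
  obtain ⟨k, hk'⟩ : ∃ k, s.nat .best 2 0 = k := ⟨_, rfl⟩
  simp only [extractCycle, wp_bind, wp_rd, wp_wr]
  simp only [hi, hj', hk'] at *
  have hs₁n := hSn j hj
  obtain ⟨f, hf⟩ : ∃ f, s.nat .listF i 0 = f := ⟨_, rfl⟩
  obtain ⟨s₁, hs₁⟩ : ∃ s₁, s.nat .listS j 0 = s₁ := ⟨_, rfl⟩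
  obtain ⟨s₂, hs₂⟩ : ∃ s₂, s.nat .listS k 0 = s₂ := ⟨_, rfl⟩
  simp only [hf, hs₁, hs₂] at *
  obtain ⟨σ, hσ⟩ : ∃ σ : Machine W, σ = ⟨upd s.nat .revLen 0 0 0, s.wt, s.time + 7⟩ := ⟨_, rfl⟩
  have hσnat : ∀ A, A ≠ .revLen → σ.nat A = s.nat A := fun A hA => by
    rw [hσ]; exact upd_of_ne hA
  have hσrev : σ.nat .revLen 0 0 = 0 := by simp [hσ, upd]
  have hσtime : σ.time = s.time + 7 := by rw [hσ]
  -- the parts of the program that are shared by several branches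
  let copy : RAM W ℕ := do
    let L ← rd .revLen 0
    upTo L (fun p => do
      wr .cyc p (← rd .rev (← subN (← subN L 1) p)))
    return L
  let closing : RAM W ℕ := do
    if ← eqN f s₁ then
      copy
    else
      trace .PFS i f s₁
      copy
  let middle : RAM W ℕ := do
    if ← eqN j k then
      if ← eqN f s₁ then
        traceBot j k
        closing
      else
        closing
    else
      traceBot j k
      closing
  have hcopy : ∀ s', Emitted (1 + n + nS * n + n) (8 + 14 * n + nS * (7 * n + 5)) σ s' →
      wp copy (fun _ s' => s'.time ≤ s.time + 100 * (nS * n + 1)) s' := by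
    intro s' hs'
    have hL : s'.nat .revLen 0 0 ≤ 1 + n + nS * n + n := by have := hs'.2.1; omega
    have ht := hs'.2.2
    simp only [copy, wp_bind, wp_rd, wp_pure]
    refine wp_mono (wp_upTo (fun p st => st.time ≤ s'.time + 2 + 5 * p) ?_ ?_) ?_
    · exact le_rfl
    · intro p st _ hst
      simp only [wp_bind, wp_subN, wp_rd, wp_wr]
      omega
    · intro _ st hst
      have h1 : nS * 1 ≤ nS * n := Nat.mul_le_mul_left _ (by omega)
      have h2 : 1 * n ≤ nS * n := Nat.mul_le_mul_right _ (by omega)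
      have h3 : nS * (7 * n + 5) = 7 * (nS * n) + 5 * nS := by ring
      omega
  have hclosing : ∀ s', Emitted (1 + n + nS * n) (7 + 7 * n + nS * (7 * n + 5)) σ s' →
      wp closing (fun _ s' => s'.time ≤ s.time + 100 * (nS * n + 1)) s' := by
    intro s' hs'
    simp only [closing, wp_bind, wp_eqN, wp_ite, decide_eq_true_eq]
    have h1 := hs'.trans (.tick s' (t := 1) le_rfl)
    refine ⟨fun _ => hcopy _ (h1.mono (by omega) (by omega)), fun hne => ?_⟩
    obtain ⟨E, reach, hc, hr⟩ := htoS hne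
    refine wp_mono (wp_trace (E := E) (s := ⟨s'.nat, s'.wt, s'.time + 1⟩) (by decide) ?_ hs₁n hr)
      fun _ s'' h'' => hcopy _ ((h1.trans h'').mono (by omega) (by omega))
    dsimp only
    rw [hs'.nat_eq (by decide), hσnat _ (by decide)]
    exact hc
  have hmiddle : ∀ s', Emitted (1 + n) (5 + 7 * n) σ s' →
      wp middle (fun _ s' => s'.time ≤ s.time + 100 * (nS * n + 1)) s' := by
    intro s' hs'
    have hB : ∀ t, t ≤ s'.time + 2 → (j = k → f = s₁) →
        wp (traceBot j k) (fun _ s' => wp closing (fun _ s' =>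
          s'.time ≤ s.time + 100 * (nS * n + 1)) s') ⟨s'.nat, s'.wt, t⟩ := by
      intro t ht hcond
      obtain ⟨E, reach, hc, hr, hE⟩ := hbot hcond
      have hnat : ∀ A, A ∉ [NArr.rev, .revLen] → s'.nat A = s.nat A := fun A hA => by
        rw [hs'.nat_eq hA, hσnat]
        rintro rfl
        simp at hA
      refine wp_mono (wp_traceBot (n := n) (nS := nS) (E := E) (reach := reach) (E' := fun _ _ => True)
        ?_ hk hr ?_ ?_)
        fun _ s'' h'' => hclosing _ (((hs'.trans (.tick s' ht)).trans h'').mono (by omega)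
          (by omega))
      · dsimp only
        rw [hnat _ (by decide)]
        exact hc
      · intro a ha b hb hab
        obtain ⟨E', reach', ⟨ord, hord⟩, hr'⟩ := hE a ha b hb hab
        dsimp only
        rw [hnat .listS (by decide), hnat .P (by decide)]
        refine ⟨reach', ⟨ord, fun v hv h => ?_⟩, hr'⟩
        obtain ⟨h1, h2, -, h3⟩ := hord v hv h
        exact ⟨h1, h2, trivial, h3⟩
      · intro a ha
        dsimp only
        rw [hnat .listS (by decide)]
        exact hSn a ha
    simp only [middle, wp_bind, wp_eqN, wp_ite, decide_eq_true_eq]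
    refine ⟨fun _ => ⟨fun hfs => hB _ le_rfl fun _ => hfs,
      fun _ => hclosing _ ((hs'.trans (.tick s' (t := 2) le_rfl)).mono (by omega) (by omega))⟩,
      fun hjk => hB _ (by omega) fun h => absurd h hjk⟩
  have hstart : wp (emit f) (fun _ s' => Emitted 1 4 σ s') σ := wp_emit f σ
  rw [hσ] at hstart
  refine wp_mono hstart fun _ s' hs' => ?_
  rw [← hσ] at hs'
  simp only [wp_eqN, wp_ite, decide_eq_true_eq]
  have h1 := hs'.trans (.tick s' (t := 1) le_rfl)
  refine ⟨fun _ => hmiddle _ (h1.mono (by omega) (by omega)), fun hne => ?_⟩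
  obtain ⟨E, reach, hc, hr⟩ := htoF hne
  rw [wp_bind]
  refine wp_mono (wp_trace (E := E) (s := ⟨s'.nat, s'.wt, s'.time + 1⟩) (by decide) ?_ hfn hr)
    fun _ s'' h'' => hmiddle _ ((h1.trans h'').mono (by omega) (by omega))
  dsimp only
  rw [hs'.nat_eq (by decide), hσnat _ (by decide)]
  exact hc

end

/-! ### The running time of Min-Bottleneck-Cycle -/

theorem lg_le_lg {a b : ℕ} (h : a ≤ b) : lg a ≤ lg b :=
  Nat.succ_le_succ (Nat.log_mono_right h)

theorem sum_adjLen {n : ℕ} {G : WGraph n} {S F : Finset (Fin n)} {μ : Machine ℝ}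
    (h : Loaded G S F μ) : ∑ u ∈ Finset.range n, μ.nat .adjLen u 0 = G.E.card := by
  rw [Finset.sum_range, Finset.card_eq_sum_card_fiberwise (f := Prod.fst) (t := Finset.univ)
    (fun _ _ => Finset.mem_univ _)]
  refine Finset.sum_congr rfl fun v _ => ?_
  rw [h.adjLen v]
  refine Finset.card_bij (fun u _ => (v, u)) ?_ ?_ ?_
  · intro u hu
    simpa [WGraph.outNbrs] using hu
  · intro a _ b _ hab
    exact (Prod.mk.inj hab).2
  · rintro ⟨a, b⟩ hab
    simp only [Finset.mem_filter] at hab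
    obtain ⟨hab, rfl⟩ := hab
    exact ⟨b, by simpa [WGraph.outNbrs] using hab, rfl⟩

/-- The running time, with an explicit constant. The summand `1` covers the case in which `S` and `F`
are empty. -/
theorem wp_minBottleneckCycle {n : ℕ} {G : WGraph n} {S F : Finset (Fin n)} {μ : Machine ℝ}
    (h : Loaded G S F μ) :
    wp minBottleneckCycle (fun _ s' => s'.time ≤
      2500 * ((S.card + F.card) * (n * lg n + G.E.card + S.card ^ 2) + 1))
      { μ with time := 0 } := by
  have hSn : ∀ i < S.card, μ.nat .listS i 0 < n := fun i hi => by
    obtain ⟨v, -, hv⟩ := h.listS.mapsTo hi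
    exact lt_of_eq_of_lt hv.symm v.2
  have hFn : ∀ i < F.card, μ.nat .listF i 0 < n := fun i hi => by
    obtain ⟨v, -, hv⟩ := h.listF.mapsTo hi
    exact lt_of_eq_of_lt hv.symm v.2
  have hG : ∀ u < n, ∀ k < μ.nat .adjLen u 0, μ.nat .adjTgt u k < n := fun u hu k hk => by
    have h1 := h.adjLen ⟨u, hu⟩
    dsimp only at h1
    obtain ⟨v, -, hv⟩ := (h.adjTgt ⟨u, hu⟩).mapsTo (show k ∈ Set.Iio _ from h1 ▸ hk)
    exact lt_of_eq_of_lt hv.symm v.2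
  have hm := sum_adjLen h
  have hnS : S.card ≤ n := by simpa using S.card_le_univ
  have hnF : F.card ≤ n := by simpa using F.card_le_univ
  obtain ⟨nS, hnS'⟩ : ∃ nS, S.card = nS := ⟨_, rfl⟩
  obtain ⟨nF, hnF'⟩ : ∃ nF, F.card = nF := ⟨_, rfl⟩
  obtain ⟨m, hm'⟩ : ∃ m, G.E.card = m := ⟨_, rfl⟩
  simp only [minBottleneckCycle, wp_bind, wp_rd, h.numV, h.numS, h.numF]
  simp only [hnS', hnF', hm'] at *
  have hlg : 1 ≤ lg n := by unfold lg; omega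
  set E := EdgeIn inputGraph μ.nat with hE
  -- the graph and the lists of vertices stay in place
  have hkeep : ∀ {s : Machine ℝ}, (∀ A ∈ [NArr.listS, .listF, .adjLen, .adjTgt],
      s.nat A = μ.nat A) →
      s.nat .listS = μ.nat .listS ∧ s.nat .listF = μ.nat .listF ∧
      s.nat .adjLen = μ.nat .adjLen ∧ s.nat .adjTgt = μ.nat .adjTgt ∧
      EdgeIn inputGraph s.nat = E := by
    intro s hs
    have h3 := hs .adjLen (by decide)
    have h4 := hs .adjTgt (by decide)
    refine ⟨hs _ (by decide), hs _ (by decide), h3, h4, ?_⟩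
    funext u v
    simp only [hE, EdgeIn, inputGraph, h3, h4]
  -- shortest paths between the vertices of `S`
  refine wp_mono (wp_shortestPath (g := inputGraph) .sum (by decide) (by decide) (by decide)
    (by decide) (by decide) (by decide) hSn hSn hG) ?_
  rintro _ s₁ ⟨hfr₁, ht₁, hrow₁⟩
  simp only [inputGraph, hm] at ht₁
  -- the graph `G_S`
  refine wp_mono (wp_buildGraphS nS s₁) ?_
  rintro _ s₂ ⟨hfr₂, ht₂, hgS⟩
  have hS₂ : ∀ i < nS, s₂.nat .idS i 0 < nS := fun i hi => by rw [(hgS i hi).1]; exact hi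
  -- bottleneck paths in `G_S`
  refine wp_mono (wp_shortestPath (g := graphS) .bottleneck (by decide) (by decide) (by decide)
    (by decide) (by decide) (by decide) hS₂ hS₂ fun u hu k hk => ((hgS u hu).2.2 k hk).1) ?_
  rintro _ s₃ ⟨hfr₃, ht₃, hrow₃⟩
  have hmS : ∑ u ∈ Finset.range nS, s₂.nat graphS.len u 0 ≤ nS * nS := by
    refine (Finset.sum_le_card_nsmul _ _ nS fun u hu =>
      (hgS u (Finset.mem_range.1 hu)).2.1).trans ?_
    simp
  obtain ⟨k1, k2, k3, k4, k5⟩ := hkeep (s := s₃) (by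
    intro A hA
    rw [hfr₃.1 A (by revert A; decide), hfr₂.1 A (by revert A; decide),
      hfr₁.1 A (by revert A; decide)])
  -- shortest paths from `F` to `S`
  refine wp_mono (wp_shortestPath (g := inputGraph) .sum (by decide) (by decide) (by decide)
    (by decide) (by decide) (by decide) (by rwa [k2]) (by rwa [k1])
    (by simp only [inputGraph]; rwa [k3, k4])) ?_
  rintro _ s₄ ⟨hfr₄, ht₄, hrow₄⟩
  rw [k1, k2, k5] at hrow₄
  simp only [inputGraph, k3, hm] at ht₄
  obtain ⟨l1, l2, l3, l4, l5⟩ := hkeep (s := s₄) (by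
    intro A hA
    rw [hfr₄.1 A (by revert A; decide), hfr₃.1 A (by revert A; decide),
      hfr₂.1 A (by revert A; decide), hfr₁.1 A (by revert A; decide)])
  -- shortest paths from `S` to `F`
  refine wp_mono (wp_shortestPath (g := inputGraph) .sum (by decide) (by decide) (by decide)
    (by decide) (by decide) (by decide) (by rwa [l1]) (by rwa [l2])
    (by simp only [inputGraph]; rwa [l3, l4])) ?_
  rintro _ s₅ ⟨hfr₅, ht₅, hrow₅⟩
  rw [l1, l2, l5] at hrow₅
  simp only [inputGraph, l3, hm] at ht₅
  obtain ⟨l1, l2, -, -, -⟩ := hkeep (s := s₅) (by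
    intro A hA
    rw [hfr₅.1 A (by revert A; decide), hfr₄.1 A (by revert A; decide),
      hfr₃.1 A (by revert A; decide), hfr₂.1 A (by revert A; decide),
      hfr₁.1 A (by revert A; decide)])
  refine wp_mono (wp_zeroEntries nF nS s₅) ?_
  rintro _ s₆ ⟨hfr₆, ht₆, hzero⟩
  refine wp_mono (wp_findBest nF nS s₆) ?_
  rintro _ s₇ ⟨hfr₇, ht₇, hbest⟩
  rw [l1, l2] at hzero
  simp only [wp_bind, wp_rdW, wp_ltW, wp_ite, decide_eq_true_eq]
  -- the bound for everything except for the extraction of the cycle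
  obtain ⟨B, hB⟩ : ∃ B, n * lg n + m + nS ^ 2 = B := ⟨_, rfl⟩
  have htime : s₇.time ≤ 2200 * ((nS + nF) * B + 1) := by
    obtain rfl | hn : n = 0 ∨ 1 ≤ n := by omega
    · obtain rfl : nS = 0 := by omega
      obtain rfl : nF = 0 := by omega
      simp only [Nat.zero_mul] at *
      omega
    have hLn : n * 1 ≤ n * lg n := Nat.mul_le_mul_left _ hlg
    have hLS : nS * lg nS ≤ n * lg n := Nat.mul_le_mul hnS (lg_le_lg hnS)
    have hsq : nS * nS = nS ^ 2 := (sq nS).symm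
    have hpow : nS * (2 + 16 * nS) = 2 * nS + 16 * nS ^ 2 := by ring
    have key : ∀ (a x c : ℕ), x ≤ c * B → a * x ≤ c * (a * B) := fun a x c hx => by
      calc a * x ≤ a * (c * B) := Nat.mul_le_mul_left _ hx
        _ = c * (a * B) := by ring
    have b1 := key nS (407 * (n * lg n + m) + 4 * nS) 411 (by omega)
    have b2 := key nS (4 + 8 * nS) 12 (by omega)
    have b3 := key nS (407 * (nS * lg nS + ∑ u ∈ Finset.range nS, s₂.nat graphS.len u 0) + 4 * nS)
      411 (by omega)
    have b4 := key nF (407 * (n * lg n + m) + 4 * nS) 411 (by omega)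
    have b5 := key nS (407 * (n * lg n + m) + 4 * nF) 411 (by omega)
    have b6 := key nF (2 + 6 * nS) 8 (by omega)
    have b7 := key nF (2 + nS * (2 + 16 * nS)) 20 (by omega)
    rw [Nat.add_mul]
    omega
  refine ⟨fun hfin => ?_, fun _ => ?_⟩
  swap
  · rw [hB]
    simp only [wp_pure]
    omega
  obtain ⟨hi, hj, hk, hDFS, hDSF, hDbot⟩ := hbest hfin
  obtain ⟨i, hi'⟩ : ∃ i, s₇.nat .best 0 0 = i := ⟨_, rfl⟩
  obtain ⟨j, hj'⟩ : ∃ j, s₇.nat .best 1 0 = j := ⟨_, rfl⟩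
  obtain ⟨k, hk'⟩ : ∃ k, s₇.nat .best 2 0 = k := ⟨_, rfl⟩
  rw [hi'] at hi hDFS hDSF hDbot
  rw [hj'] at hj hDFS hDbot
  rw [hk'] at hk hDSF hDbot
  have hlist : ∀ A ∈ [NArr.listS, .listF, .adjLen, .adjTgt], s₇.nat A = μ.nat A := by
    intro A hA
    rw [hfr₇.1 A (by revert A; decide), hfr₆.1 A (by simp), hfr₅.1 A (by revert A; decide),
      hfr₄.1 A (by revert A; decide), hfr₃.1 A (by revert A; decide),
      hfr₂.1 A (by revert A; decide), hfr₁.1 A (by revert A; decide)]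
  obtain ⟨q1, q2, -, -, -⟩ := hkeep hlist
  have hPSF : s₇.nat .PSF = s₅.nat .PSF := by rw [hfr₇.1 _ (by decide), hfr₆.1 _ (by simp)]
  have hPFS : s₇.nat .PFS = s₄.nat .PFS := by
    rw [hfr₇.1 _ (by decide), hfr₆.1 _ (by simp), hfr₅.1 _ (by decide)]
  have hPbot : s₇.nat .Pbot = s₃.nat .Pbot := by
    rw [hfr₇.1 _ (by decide), hfr₆.1 _ (by simp), hfr₅.1 _ (by decide), hfr₄.1 _ (by decide)]
  have hP : s₇.nat .P = s₁.nat .P := by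
    rw [hfr₇.1 _ (by decide), hfr₆.1 _ (by simp), hfr₅.1 _ (by decide), hfr₄.1 _ (by decide),
      hfr₃.1 _ (by decide), hfr₂.1 _ (by decide)]
  have hDbot₆ : s₆.wt .Dbot = s₃.wt .Dbot := by
    rw [hfr₆.2 _ (by decide), hfr₅.2 _ (by decide), hfr₄.2 _ (by decide)]
  rw [hfr₆.1 .listF (by simp), hfr₆.1 .listS (by simp), l1, l2, hDbot₆] at hDbot
  have htrace : Traceable n nS s₇ := by
    refine ⟨?_, ?_, ?_, ?_, ?_, ?_⟩ <;> simp only [hi', hj', hk', q1, q2, hPSF, hPFS, hPbot, hP]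
    · exact hFn i hi
    · exact hSn
    · exact ⟨hj, hk⟩
    · intro hne
      obtain ⟨reach, hc, hr⟩ := hrow₅ k hk
      refine ⟨E, reach, hc, hr i hi ?_⟩
      rwa [← (hzero i k hne).2]
    · intro hne
      obtain ⟨reach, hc, hr⟩ := hrow₄ i hi
      refine ⟨E, reach, hc, hr j hj ?_⟩
      rwa [← hfr₅.2 .DFS (by decide), ← (hzero i j hne).1]
    · intro hcond
      obtain ⟨reach, hc, hr⟩ := hrow₃ j hj
      have hr' := hr k hk (hDbot hcond)
      rw [(hgS k hk).1] at hr'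
      rw [(hgS j hj).1] at hc
      refine ⟨_, reach, hc, hr', ?_⟩
      rintro a ha b hb ⟨l, hl, rfl⟩
      obtain ⟨reach', hc', hr''⟩ := hrow₁ a ha
      exact ⟨_, reach', hc', hr'' _ hb ((hgS a ha).2.2 l hl).2⟩
  refine wp_mono (wp_extractCycle (n := n) (nS := nS) (s := ⟨s₇.nat, s₇.wt, s₇.time + 1 + 1⟩) ⟨htrace.1, htrace.2,
    htrace.3, htrace.4, htrace.5, htrace.6⟩) fun L s₈ h₈ => ?_
  rw [hB]
  simp only [wp_pure]
  have h1 : nS * n ≤ (nS + nF) * B := by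
    refine Nat.mul_le_mul (by omega) ?_
    have : n * 1 ≤ n * lg n := Nat.mul_le_mul_left _ hlg
    omega
  dsimp only at h₈
  omega

theorem haltsWithin_minBottleneckCycle {n : ℕ} {G : WGraph n} {S F : Finset (Fin n)}
    {μ : Machine ℝ} (h : Loaded G S F μ) {T : ℝ}
    (hT : ((2500 * ((S.card + F.card) * (n * lg n + G.E.card + S.card ^ 2) + 1) : ℕ) : ℝ) ≤ T) :
    HaltsWithin minBottleneckCycle μ T := by
  obtain ⟨a, μ', h1, h2⟩ := wp_minBottleneckCycle h
  exact ⟨a, μ', h1, (Nat.cast_le.2 h2).trans hT⟩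

theorem lg_le_mul_log {n : ℕ} (hn : 2 ≤ n) : (lg n : ℝ) ≤ 4 * Real.log n := by
  have h2 : (1 : ℝ) / 2 < Real.log 2 := by have := Real.log_two_gt_d9; linarith
  have h1 : (Nat.log 2 n : ℝ) * Real.log 2 ≤ Real.log n := by
    rw [← Real.log_pow]
    refine Real.log_le_log (by positivity) ?_
    exact_mod_cast Nat.pow_log_le_self 2 (by omega)
  have h3 : Real.log 2 ≤ Real.log n := Real.log_le_log (by norm_num) (by exact_mod_cast hn)
  have h4 : (0 : ℝ) ≤ Nat.log 2 n := Nat.cast_nonneg _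
  unfold lg
  push_cast
  nlinarith

theorem haltsWithin_of_two_le {n : ℕ} {G : WGraph n} {S F : Finset (Fin n)}
    {μ : Machine ℝ} (hn : 2 ≤ n) (hSF : (S ∪ F).Nonempty) (h : Loaded G S F μ) :
    HaltsWithin minBottleneckCycle μ
      (12500 * (((S.card : ℝ) + F.card) *
        (n * Real.log n + G.E.card + (S.card : ℝ) ^ 2))) := by
  refine haltsWithin_minBottleneckCycle h ?_
  have h1 := lg_le_mul_log hn
  have h2 : (2 : ℝ) ≤ lg n := by
    exact_mod_cast Nat.succ_le_succ (Nat.log_pos (b := 2) (by norm_num) hn)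
  have h3 : (1 : ℝ) ≤ (S.card : ℝ) + F.card := by
    have h4 := Finset.card_union_le S F
    have h5 := hSF.card_pos
    exact_mod_cast (by omega : 1 ≤ S.card + F.card)
  have hn' : (2 : ℝ) ≤ n := by exact_mod_cast hn
  have h6 : (n : ℝ) * lg n ≤ 4 * (n * Real.log n) := by nlinarith
  have h7 : (1 : ℝ) ≤ n * Real.log n := by nlinarith
  push_cast
  set A := (n : ℝ) * Real.log n
  set D := (S.card : ℝ) + F.card
  have h8 : (0 : ℝ) ≤ G.E.card := Nat.cast_nonneg _
  have h9 : (0 : ℝ) ≤ (S.card : ℝ) ^ 2 := by positivity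
  have h10 : D * (n * lg n + G.E.card + (S.card : ℝ) ^ 2) ≤
      D * (4 * A + G.E.card + (S.card : ℝ) ^ 2) := by
    gcongr
  nlinarith [mul_le_mul h3 h7 zero_le_one (by linarith), mul_nonneg (by linarith : 0 ≤ D) h8,
    mul_nonneg (by linarith : 0 ≤ D) h9]

end MBC

theorem mainTheorem5 :
    -- general bound
    (∃ C : ℝ, ∀ (n : ℕ) (G : WGraph n) (S F : Finset (Fin n)) (μ : MBC.Machine ℝ),
      2 ≤ n → (S ∪ F).Nonempty → MBC.Loaded G S F μ →
        MBC.HaltsWithin MBC.minBottleneckCycle μ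
          (C * (((S.card : ℝ) + F.card) *
            (n * Real.log n + G.E.card + (S.card : ℝ) ^ 2)))) ∧
    -- worst case
    (∃ C : ℝ, ∀ (n : ℕ) (G : WGraph n) (S F : Finset (Fin n)) (μ : MBC.Machine ℝ),
      1 ≤ n → MBC.Loaded G S F μ →
        MBC.HaltsWithin MBC.minBottleneckCycle μ (C * (n : ℝ) ^ 3)) ∧
    -- sparse graphs, few vertices in `S`
    (∀ K : ℝ, ∃ C : ℝ, ∀ (n : ℕ) (G : WGraph n) (S F : Finset (Fin n)) (μ : MBC.Machine ℝ),
      2 ≤ n → (S ∪ F).Nonempty → (G.E.card : ℝ) ≤ K * n →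
        (S.card : ℝ) ^ 2 ≤ K * (n * Real.log n) → MBC.Loaded G S F μ →
          MBC.HaltsWithin MBC.minBottleneckCycle μ
            (C * (((S.card : ℝ) + F.card) * (n * Real.log n)))) := by
  refine ⟨⟨12500, fun n G S F μ hn hSF h => MBC.haltsWithin_of_two_le hn hSF h⟩,
    ⟨17500, fun n G S F μ hn h => MBC.haltsWithin_minBottleneckCycle h ?_⟩,
    fun K => ⟨12500 * (1 + 2 * |K| + |K|), fun n G S F μ hn hSF hE hS h => ?_⟩⟩
  · have hS : S.card ≤ n := by simpa using S.card_le_univ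
    have hF : F.card ≤ n := by simpa using F.card_le_univ
    have hE : G.E.card ≤ n ^ 2 := by
      simpa [sq] using G.E.card_le_univ
    have hlg : MBC.lg n ≤ n := Nat.log_lt_self 2 (by omega)
    have h1 : (S.card + F.card) * (n * MBC.lg n + G.E.card + S.card ^ 2) ≤
        (n + n) * (n * n + n ^ 2 + n ^ 2) := by gcongr
    have h2 : (n + n) * (n * n + n ^ 2 + n ^ 2) = 6 * n ^ 3 := by ring
    have h3 : 1 ≤ n ^ 3 := Nat.one_le_pow _ _ hn
    exact_mod_cast (by omega :
      2500 * ((S.card + F.card) * (n * MBC.lg n + G.E.card + S.card ^ 2) + 1) ≤ 17500 * n ^ 3)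
  · obtain ⟨a, μ', h1, h2⟩ := MBC.haltsWithin_of_two_le hn hSF h
    refine ⟨a, μ', h1, h2.trans ?_⟩
    have h3 : (1 : ℝ) / 2 ≤ Real.log n := by
      have h4 : Real.log 2 ≤ Real.log n := Real.log_le_log (by norm_num) (by exact_mod_cast hn)
      have := Real.log_two_gt_d9
      linarith
    have hn' : (2 : ℝ) ≤ n := by exact_mod_cast hn
    have h5 : K * n ≤ 2 * |K| * (n * Real.log n) := by
      have h6 : (n : ℝ) ≤ 2 * (n * Real.log n) := by nlinarith
      calc K * n ≤ |K| * n := by gcongr; exact le_abs_self K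
        _ ≤ |K| * (2 * (n * Real.log n)) := by gcongr
        _ = 2 * |K| * (n * Real.log n) := by ring
    have h7 : K * (n * Real.log n) ≤ |K| * (n * Real.log n) := by gcongr; exact le_abs_self K
    have h8 : (n : ℝ) * Real.log n + G.E.card + (S.card : ℝ) ^ 2 ≤
        (1 + 2 * |K| + |K|) * (n * Real.log n) := by linarith
    calc 12500 * (((S.card : ℝ) + F.card) * (n * Real.log n + G.E.card + (S.card : ℝ) ^ 2))
        ≤ 12500 * (((S.card : ℝ) + F.card) * ((1 + 2 * |K| + |K|) * (n * Real.log n))) := by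
          gcongr
      _ = _ := by ring
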